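/- Let $\alpha_1,\alpha_2\ge 0$ be constants and, for each $n$, let $m_1=m_1(n)$ and $m_2=m_2(n)$ be nonnegative integers with $m_i/n\to\alpha_i$ as $n\to\infty$ (for instance $m_i=\alpha_i n$ up to rounding). For each $n$ let $A\in\mathbb R^{m_1\times n}$ and $B\in\mathbb R^{m_2\times n}$ be random matrices all of whose entries (of $A$ and $B$ jointly) are i.i.d. standard normal, let $g\in\mathbb R^n$ be a random vector with i.i.d. standard normal components, and let $f=f_n:\mathbb R^n\to\mathbb R$ be a given deterministic function. Put $$\xi(f,A,B)=\inf\{f(x): x\in\mathbb R^n,\ Ax=0,\ Bx\le 0\}\in[-\infty,\infty],$$ and say that events $E_n$ hold with overwhelming probability if there is $c>0$ with $P(E_n)\ge 1-e^{-cn}$ for all large $n$. Assume that $|\xi(f,A,B)|<\infty$ with overwhelming probability. Let $\varepsilon_1,\varepsilon_5>0$ be arbitrary constants independent of $n$, and for a scalar $t$ put $$L^{(1)}(t)=\inf\Big\{f(x)-t:\ x\in\mathbb R^n,\ g^Tx+\|x\|_2\big((1-\varepsilon_1)\sqrt{m_1+m_2/2}-\varepsilon_5\sqrt n\big)\le 0\Big\}.$$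 Let $\xi_D^{(l)}=\xi_D^{(l)}(f_n)$ be any (in particular, the largest, if there is a largest) scalars, depending on $n$, such that $L^{(1)}(\xi_D^{(l)})\ge 0$ with overwhelming probability. Then $$\lim_{n\to\infty}P\big(\xi(f,A,B)\ge\xi_D^{(l)}(f)\big)=1 .$$ If moreover $L^{(1)}(\xi_D^{(l)})>0$ with overwhelming probability, then $$\lim_{n\to\infty}P\big(\xi(f,A,B)>\xi_D^{(l)}(f)\big)=1 .$$ (For functions $f$ for which these events are not measurable, $P$ denotes the inner probability.) -/

import Mathlib

open MeasureTheory ProbabilityTheory Filter Topology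
open scoped Matrix

namespace RandLinCons

/-- The feasible set `{x ∈ ℝⁿ : A x = 0, B x ≤ 0}` (the inequality is componentwise). -/
def feasibleSet {m₁ m₂ n : ℕ} (A : Matrix (Fin m₁) (Fin n) ℝ) (B : Matrix (Fin m₂) (Fin n) ℝ) :
    Set (EuclideanSpace ℝ (Fin n)) :=
  {x | A *ᵥ x.ofLp = 0 ∧ B *ᵥ x.ofLp ≤ 0}

/-- The optimal value `ξ(f, A, B)` of `min f(x)` subject to `A x = 0`, `B x ≤ 0`,
as an extended real number (`⊥` if the program is unbounded below). -/
noncomputable def xi {m₁ m₂ n : ℕ} (f : EuclideanSpace ℝ (Fin n) → ℝ)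
    (A : Matrix (Fin m₁) (Fin n) ℝ) (B : Matrix (Fin m₂) (Fin n) ℝ) : EReal :=
  ⨅ x ∈ feasibleSet A B, (f x : EReal)

/-- The feasible set of the auxiliary program:
`gᵀ x + ‖x‖₂ ((1 - ε₁) √(m₁ + m₂ / 2) - ε₅ √n) ≤ 0`. -/
def auxFeasibleSet {n : ℕ} (m₁ m₂ : ℕ) (ε₁ ε₅ : ℝ) (g : Fin n → ℝ) :
    Set (EuclideanSpace ℝ (Fin n)) :=
  {x | g ⬝ᵥ x.ofLp
      + ‖x‖ * ((1 - ε₁) * √((m₁ : ℝ) + (m₂ : ℝ) / 2) - ε₅ * √(n : ℝ)) ≤ 0}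

/-- The optimal value `L⁽¹⁾` of the auxiliary program: `min (f(x) - t)` over `auxFeasibleSet`,
as an extended real number. -/
noncomputable def auxL {n : ℕ} (f : EuclideanSpace ℝ (Fin n) → ℝ) (t : ℝ)
    (m₁ m₂ : ℕ) (ε₁ ε₅ : ℝ) (g : Fin n → ℝ) : EReal :=
  ⨅ x ∈ auxFeasibleSet m₁ m₂ ε₁ ε₅ g, ((f x - t : ℝ) : EReal)

/-- The random variables `X i` are i.i.d. standard normal. -/
def IsIIDStdNormal {Ω ι : Type*} [MeasurableSpace Ω] (X : ι → Ω → ℝ) (P : Measure Ω) : Prop :=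
  (∀ i, HasLaw (X i) (gaussianReal 0 1) P) ∧ iIndepFun X P

/-- All entries of the two random matrices together, as one family of random variables. -/
def entries {Ω : Type*} {m₁ m₂ n : ℕ} (A : Ω → Matrix (Fin m₁) (Fin n) ℝ)
    (B : Ω → Matrix (Fin m₂) (Fin n) ℝ) :
    (Fin m₁ × Fin n) ⊕ (Fin m₂ × Fin n) → Ω → ℝ :=
  Sum.elim (fun p ω => A ω p.1 p.2) (fun p ω => B ω p.1 p.2)

/-- The (inner) probability of an event: `1` minus the outer measure of the complement.
It is `P s` for every (null-)measurable event, see `prob_eq`, and for the events of an arbitrary,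
possibly non-measurable, objective function a lower bound on it is the stronger claim. -/
noncomputable def prob {Ω : Type*} [MeasurableSpace Ω] (P : Measure Ω) (s : Set Ω) : ℝ :=
  1 - P.real sᶜ

theorem prob_eq {Ω : Type*} [MeasurableSpace Ω] (P : Measure Ω) [IsProbabilityMeasure P]
    {s : Set Ω} (hs : NullMeasurableSet s P) : prob P s = P.real s := by
  unfold prob
  rw [measureReal_def, measureReal_def, prob_compl_eq_one_sub₀ hs,
    ENNReal.toReal_sub_of_le prob_le_one ENNReal.one_ne_top]
  simp

/-- The events `s n` hold with overwhelming probability: the probability is at most a number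
exponentially decaying in `n` away from `1`. -/
def WithOverwhelmingProb {Ω : ℕ → Type*} [∀ n, MeasurableSpace (Ω n)]
    (P : ∀ n, Measure (Ω n)) (s : ∀ n, Set (Ω n)) : Prop :=
  ∃ c : ℝ, 0 < c ∧ ∀ᶠ n : ℕ in atTop, 1 - Real.exp (-c * (n : ℝ)) ≤ prob (P n) (s n)

end RandLinCons

/-!
For unit vectors `x` and vectors `y` of norm at most one, the Gaussian processes `yᵀ G x + s` and
`gᵀ x + hᵀ y` satisfy the covariance hypotheses of Gordon's min-max comparison. That comparison
holds because rotating one Gaussian vector into another and integrating by parts expresses the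
derivative of the expectation of a test function through its second partial derivatives weighted by
the differences of the covariances; for a product over `x` of monotone functions of the blocks
`(x, ·)` each weighted term has a sign.

Let `G` be `A` stacked on `B`, and let `y` range over the vectors of the unit ball that are
nonnegative in the `B`-block. If some `x` with `f x < t` is feasible, then `yᵀ G x ≤ 0` for all such
`y`. By the comparison this is at most as likely, up to small errors, as the existence of an `x`
with `f x < t` and `gᵀ x + ‖x‖ max_y hᵀ y ≤ 0`. The square of `max_y hᵀ y` has mean `m₁ + m₂ / 2`
and variance `O(m₁ + m₂)`, so by Chebyshev's inequality `max_y hᵀ y ≥ √(m₁ + m₂ / 2) - δ √n` outside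
an event of probability `O(1 / n)`, uniformly in `m₁` and `m₂`.
-/

namespace RandLinCons

section Gaussian

variable {E F : Type*} [NormedAddCommGroup E] [NormedSpace ℝ E] [NormedAddCommGroup F]
  [NormedSpace ℝ F]

theorem hasTemperateGrowth_fderiv {f : E → F} (hf : f.HasTemperateGrowth) :
    (fderiv ℝ f).HasTemperateGrowth := by
  refine ⟨hf.1.fderiv_right le_rfl, fun n => ?_⟩
  obtain ⟨k, C, hC⟩ := hf.2 (n + 1)
  exact ⟨k, C, fun x => by simpa only [norm_iteratedFDeriv_fderiv] using hC x⟩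

theorem hasTemperateGrowth_fderiv_apply {f : E → F} (hf : f.HasTemperateGrowth) (v : E) :
    (fun x => fderiv ℝ f x v).HasTemperateGrowth :=
  (ContinuousLinearMap.apply ℝ F v).hasTemperateGrowth.comp (hasTemperateGrowth_fderiv hf)

theorem hasTemperateGrowth_finset_prod {ι : Type*} (s : Finset ι) {f : ι → E → ℝ}
    (hf : ∀ i ∈ s, (f i).HasTemperateGrowth) : (fun x => ∏ i ∈ s, f i x).HasTemperateGrowth := by
  classical
  induction s using Finset.induction_on with
  | empty => simp only [Finset.prod_empty]; fun_prop
  | insert i s hi ih =>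
    simp only [Finset.prod_insert hi]
    exact (hf i (Finset.mem_insert_self i s)).fun_mul
      (ih fun j hj => hf j (Finset.mem_insert_of_mem hj))

@[fun_prop]
theorem hasTemperateGrowth_fst : (Prod.fst : E × F → E).HasTemperateGrowth :=
  (ContinuousLinearMap.fst ℝ E F).hasTemperateGrowth

@[fun_prop]
theorem hasTemperateGrowth_snd : (Prod.snd : E × F → F).HasTemperateGrowth :=
  (ContinuousLinearMap.snd ℝ E F).hasTemperateGrowth

@[fun_prop]
theorem hasTemperateGrowth_eval {κ : Type*} [Fintype κ] (a : κ) :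
    (fun z : κ → ℝ => z a).HasTemperateGrowth :=
  (ContinuousLinearMap.proj (R := ℝ) (φ := fun _ : κ => ℝ) a).hasTemperateGrowth

variable [MeasurableSpace E] [BorelSpace E]

/-- The covariance operator of `μ`, which sends a continuous linear form `L` to the covariance of
`L` with the identity, a vector of the underlying space. -/
noncomputable def covarianceOperator (μ : Measure E) (L : StrongDual ℝ E) : E :=
  ∫ z, (L z - μ[L]) • z ∂μ

theorem exists_variance_smul_eq_covarianceOperator (μ : Measure E) [IsGaussian μ]
    (L : StrongDual ℝ E) : ∃ a : E, Var[L; μ] • a = covarianceOperator μ L := by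
  rcases eq_or_ne Var[L; μ] 0 with hv | hv
  · have hL := ae_eq_integral_of_variance_eq_zero (IsGaussian.memLp_dual μ L 2 (by simp)) hv
    refine ⟨0, ?_⟩
    rw [smul_zero, covarianceOperator, eq_comm]
    refine integral_eq_zero_of_ae ?_
    filter_upwards [hL] with z hz
    simp only [hz, sub_self, zero_smul, Pi.zero_apply]
  · exact ⟨Var[L; μ]⁻¹ • covarianceOperator μ L, smul_inv_smul₀ hv _⟩

variable [CompleteSpace E] [SecondCountableTopology E]

theorem integrable_one_add_norm_pow (μ : Measure E) [IsGaussian μ] (k : ℕ) :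
    Integrable (fun z : E => (1 + ‖z‖) ^ k) μ := by
  have h : MemLp (fun z : E => 1 + ‖z‖) k μ :=
    (memLp_const (1 : ℝ)).add (IsGaussian.memLp_id μ k (ENNReal.natCast_ne_top k)).norm
  refine h.integrable_norm_pow'.congr (ae_of_all _ fun z => ?_)
  beta_reduce
  rw [Real.norm_of_nonneg (by positivity)]

theorem integrable_of_hasTemperateGrowth [SecondCountableTopologyEither E F] (μ : Measure E)
    [IsGaussian μ] {f : E → F} (hf : f.HasTemperateGrowth) : Integrable f μ := by
  obtain ⟨k, C, hC⟩ := hf.2 0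
  refine ((integrable_one_add_norm_pow μ k).const_mul C).mono'
    hf.1.continuous.aestronglyMeasurable (ae_of_all _ fun z => ?_)
  simpa only [norm_iteratedFDeriv_zero] using hC z

theorem hasDerivAt_gaussianPDFReal (m : ℝ) {v : NNReal} (hv : v ≠ 0) (x : ℝ) :
    HasDerivAt (gaussianPDFReal m v) (-((x - m) / v * gaussianPDFReal m v x)) x := by
  have hexp : HasDerivAt (fun x : ℝ => -(x - m) ^ 2 / (2 * v)) (-((x - m) / v)) x := by
    refine ((((hasDerivAt_id x).sub_const m).pow 2).neg.div_const (2 * v : ℝ)).congr_deriv ?_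
    simp only [Nat.cast_ofNat, id_eq, Nat.add_one_sub_one, pow_one, mul_one]
    field_simp
  rw [gaussianPDFReal_def]
  exact (hexp.exp.const_mul _).congr_deriv (by ring)

theorem integrable_gaussianReal_iff {m : ℝ} {v : NNReal} (hv : v ≠ 0) {f : ℝ → ℝ} :
    Integrable f (gaussianReal m v) ↔ Integrable (fun x => f x * gaussianPDFReal m v x) := by
  rw [gaussianReal_of_var_ne_zero m hv,
    integrable_withDensity_iff_integrable_smul' (measurable_gaussianPDF _ _)
      (ae_of_all _ fun _ => gaussianPDF_lt_top)]
  simp only [toReal_gaussianPDF, smul_eq_mul, mul_comm]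

theorem integral_sub_mul_gaussianReal (m : ℝ) (v : NNReal) {f : ℝ → ℝ}
    (hf : f.HasTemperateGrowth) :
    ∫ x, (x - m) * f x ∂gaussianReal m v = v * ∫ x, deriv f x ∂gaussianReal m v := by
  rcases eq_or_ne v 0 with rfl | hv
  · simp
  have hf' : (deriv f).HasTemperateGrowth := by
    simpa only [fderiv_apply_one_eq_deriv] using hasTemperateGrowth_fderiv_apply hf (1 : ℝ)
  have integrable_mul_pdf {u : ℝ → ℝ} (hu : u.HasTemperateGrowth) :
      Integrable (fun x => u x * gaussianPDFReal m v x) :=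
    (integrable_gaussianReal_iff hv).1 (integrable_of_hasTemperateGrowth _ hu)
  have hxf : Function.HasTemperateGrowth fun x => (m - x) / v * f x := by
    simp only [div_eq_mul_inv]; fun_prop
  have key := integral_mul_deriv_eq_deriv_mul_of_integrable
    (fun x _ => (hf.1.differentiable (by simp) x).hasDerivAt)
    (fun x _ => hasDerivAt_gaussianPDFReal m hv x)
    ((integrable_mul_pdf hxf).congr (ae_of_all _ fun x => by simp only [Pi.mul_apply]; ring))
    (integrable_mul_pdf hf') (integrable_mul_pdf hf)
  simp only [integral_gaussianReal_eq_integral_smul hv, smul_eq_mul]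
  calc ∫ x, gaussianPDFReal m v x * ((x - m) * f x)
      = -(v * ∫ x, f x * -((x - m) / v * gaussianPDFReal m v x)) := by
        rw [← integral_const_mul, ← integral_neg]
        exact integral_congr_ae (ae_of_all _ fun x => by field_simp)
    _ = v * ∫ x, gaussianPDFReal m v x * deriv f x := by
        rw [key, mul_neg, neg_neg]
        simp only [mul_comm]

theorem map_covarianceOperator {G : Type*} [NormedAddCommGroup G] [NormedSpace ℝ G]
    [CompleteSpace G] (μ : Measure E) [IsGaussian μ] (L : StrongDual ℝ E) (T : E →L[ℝ] G) :
    T (covarianceOperator μ L) = ∫ z, (L z - μ[L]) • T z ∂μ := by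
  have h_int : Integrable (fun z => (L z - μ[L]) • z) μ :=
    integrable_of_hasTemperateGrowth μ (by fun_prop)
  simp only [covarianceOperator, ← T.integral_comp_comm h_int, map_smul]

theorem dual_covarianceOperator (μ : Measure E) [IsGaussian μ] (L M : StrongDual ℝ E) :
    M (covarianceOperator μ L) = cov[L, M; μ] := by
  rw [map_covarianceOperator, covariance_eq_sub (IsGaussian.memLp_dual μ L 2 (by simp))
    (IsGaussian.memLp_dual μ M 2 (by simp))]
  simp only [smul_eq_mul, sub_mul, Pi.mul_apply]
  rw [integral_sub (integrable_of_hasTemperateGrowth μ (by fun_prop))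
    (integrable_of_hasTemperateGrowth μ (by fun_prop)), integral_const_mul]

theorem indepFun_sub_smulRight {μ : Measure E} [IsGaussian μ] {L : StrongDual ℝ E} {a : E}
    (ha : Var[L; μ] • a = covarianceOperator μ L) :
    IndepFun L (ContinuousLinearMap.id ℝ E - L.smulRight a) μ := by
  set W := ContinuousLinearMap.id ℝ E - L.smulRight a
  refine (IsGaussian.hasGaussianLaw_id.map_fun (L.prod W)).indepFun_of_covariance_strongDual
    fun c M => ?_
  have h_left : c ∘ L = fun z => L z * c 1 := by
    ext z
    simpa using c.map_smul (L z) 1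
  have h_right : M ∘ W = fun z => M z - L z * M a := by
    ext z
    simp [W]
  have hL := IsGaussian.memLp_dual μ L 2 (by simp)
  change cov[c ∘ L, M ∘ W; μ] = 0
  rw [h_left, h_right, covariance_mul_const_left, covariance_fun_sub_right hL
    (IsGaussian.memLp_dual μ M 2 (by simp)) (hL.mul_const _), covariance_mul_const_right,
    ← dual_covarianceOperator, ← ha, map_smul, covariance_self (by fun_prop), smul_eq_mul, sub_self,
    zero_mul]

theorem integral_eq_integral_gaussianReal_integral {μ : Measure E} [IsGaussian μ]
    {L : StrongDual ℝ E} {a : E} (ha : Var[L; μ] • a = covarianceOperator μ L) {f : ℝ × E → ℝ}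
    (hf : f.HasTemperateGrowth) :
    ∫ z, f (L z, z - L z • a) ∂μ =
      ∫ w, ∫ t, f (t, w) ∂gaussianReal μ[L] Var[L; μ].toNNReal
        ∂μ.map (ContinuousLinearMap.id ℝ E - L.smulRight a) := by
  have h_law := (indepFun_sub_smulRight ha).map_prod_eq_prod_map_map (by fun_prop) (by fun_prop)
  rw [IsGaussian.map_eq_gaussianReal L] at h_law
  rw [← integral_prod_symm f (integrable_of_hasTemperateGrowth _ hf), ← h_law,
    integral_map (by fun_prop) hf.1.continuous.aestronglyMeasurable]
  rfl

theorem integral_dual_sub_mul_eq_integral_fderiv (μ : Measure E) [IsGaussian μ]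
    (L : StrongDual ℝ E) {f : E → ℝ} (hf : f.HasTemperateGrowth) :
    ∫ z, (L z - μ[L]) * f z ∂μ = ∫ z, fderiv ℝ f z (covarianceOperator μ L) ∂μ := by
  obtain ⟨a, ha⟩ := exists_variance_smul_eq_covarianceOperator μ L
  have hshift : Function.HasTemperateGrowth fun p : ℝ × E => p.1 • a + p.2 := by
    fun_prop
  have hderiv (w : E) (t : ℝ) :
      deriv (fun s : ℝ => f (s • a + w)) t = fderiv ℝ f (t • a + w) a := by
    have hline : HasDerivAt (fun s : ℝ => s • a + w) a t := by
      simpa using ((hasDerivAt_id t).smul_const a).add_const w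
    exact ((hf.1.differentiable (by simp) _).hasFDerivAt.comp_hasDerivAt t hline).deriv
  have by_parts (w : E) :
      ∫ t, (t - μ[L]) * f (t • a + w) ∂gaussianReal μ[L] Var[L; μ].toNNReal =
        ∫ t, fderiv ℝ f (t • a + w) (covarianceOperator μ L)
          ∂gaussianReal μ[L] Var[L; μ].toNNReal := by
    have hline : Function.HasTemperateGrowth fun s : ℝ => s • a + w := by fun_prop
    refine (integral_sub_mul_gaussianReal _ _ (hf.comp hline)).trans ?_
    rw [← integral_const_mul]
    simp only [Function.comp_def, hderiv, Real.coe_toNNReal _ (variance_nonneg _ _), ← ha,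
      map_smul, smul_eq_mul]
  calc ∫ z, (L z - μ[L]) * f z ∂μ
      = ∫ w, ∫ t, (t - μ[L]) * f (t • a + w) ∂gaussianReal μ[L] Var[L; μ].toNNReal
          ∂μ.map (ContinuousLinearMap.id ℝ E - L.smulRight a) := by
        rw [← integral_eq_integral_gaussianReal_integral ha
          (f := fun p => (p.1 - μ[L]) * f (p.1 • a + p.2)) (by fun_prop)]
        simp only [add_sub_cancel]
    _ = ∫ z, fderiv ℝ f z (covarianceOperator μ L) ∂μ := by
        simp only [by_parts]
        rw [← integral_eq_integral_gaussianReal_integral ha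
          (f := fun p => fderiv ℝ f (p.1 • a + p.2) (covarianceOperator μ L))
          ((hasTemperateGrowth_fderiv_apply hf _).comp hshift)]
        simp only [add_sub_cancel]

end Gaussian

section Interpolation

theorem covariance_fst_add_snd_prod {Ω Ω' : Type*} [MeasurableSpace Ω] [MeasurableSpace Ω']
    {P : Measure Ω} [IsProbabilityMeasure P] {Q : Measure Ω'} [IsProbabilityMeasure Q]
    {X X' : Ω → ℝ} {Y Y' : Ω' → ℝ} (hX : MemLp X 2 P) (hX' : MemLp X' 2 P) (hY : MemLp Y 2 Q)
    (hY' : MemLp Y' 2 Q) :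
    cov[fun p => X p.1 + Y p.2, fun p => X' p.1 + Y' p.2; P.prod Q] =
      cov[X, X'; P] + cov[Y, Y'; Q] := by
  have cov_fst : cov[fun p => X p.1, fun p => X' p.1; P.prod Q] = cov[X, X'; P] := by
    have h := (measurePreserving_fst (μ := P) (ν := Q)).map_eq
    rw [← covariance_map_fun (X := X) (Y := X') (by rw [h]; exact hX.1) (by rw [h]; exact hX'.1)
      measurable_fst.aemeasurable, h]
  have cov_snd : cov[fun p => Y p.2, fun p => Y' p.2; P.prod Q] = cov[Y, Y'; Q] := by
    have h := (measurePreserving_snd (μ := P) (ν := Q)).map_eq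
    rw [← covariance_map_fun (X := Y) (Y := Y') (by rw [h]; exact hY.1) (by rw [h]; exact hY'.1)
      measurable_snd.aemeasurable, h]
  have cov_snd_fst : cov[fun p => Y p.2, fun p => X' p.1; P.prod Q] = 0 := by
    rw [covariance_comm, covariance_fst_snd_prod hX' hY]
  change cov[(fun p : Ω × Ω' => X p.1) + fun p : Ω × Ω' => Y p.2,
    (fun p : Ω × Ω' => X' p.1) + fun p : Ω × Ω' => Y' p.2; _] = _
  rw [covariance_add_left (hX.comp_fst Q) (hY.comp_snd P) ((hX'.comp_fst Q).add (hY'.comp_snd P)),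
    covariance_add_right (hX.comp_fst Q) (hX'.comp_fst Q) (hY'.comp_snd P),
    covariance_add_right (hY.comp_snd P) (hX'.comp_fst Q) (hY'.comp_snd P), cov_fst, cov_snd,
    cov_snd_fst, covariance_fst_snd_prod hX hY', add_zero, zero_add]

variable {E : Type*} [NormedAddCommGroup E] [NormedSpace ℝ E]

/-- The interpolation `cos θ • x + sin θ • y` between two points, as a continuous linear map of the
pair `(x, y)`. Its derivative in `θ` is `rotation (θ + π / 2)`. -/
noncomputable def rotation (θ : ℝ) : E × E →L[ℝ] E :=
  Real.cos θ • ContinuousLinearMap.fst ℝ E E + Real.sin θ • ContinuousLinearMap.snd ℝ E E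

theorem rotation_apply (θ : ℝ) (p : E × E) :
    rotation θ p = Real.cos θ • p.1 + Real.sin θ • p.2 := rfl

theorem hasDerivAt_rotation (θ : ℝ) (p : E × E) :
    HasDerivAt (fun s => rotation s p) (rotation (θ + Real.pi / 2) p) θ := by
  rw [rotation_apply, Real.cos_add_pi_div_two, Real.sin_add_pi_div_two]
  exact ((Real.hasDerivAt_cos θ).smul_const p.1).add ((Real.hasDerivAt_sin θ).smul_const p.2)

theorem norm_rotation_le (θ : ℝ) (p : E × E) : ‖rotation θ p‖ ≤ 2 * ‖p‖ := by
  have norm_smul_le {c : ℝ} {z : E} (hc : |c| ≤ 1) (hz : ‖z‖ ≤ ‖p‖) : ‖c • z‖ ≤ ‖p‖ := by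
    rw [norm_smul, Real.norm_eq_abs]
    exact (mul_le_of_le_one_left (norm_nonneg z) hc).trans hz
  calc ‖rotation θ p‖ ≤ ‖Real.cos θ • p.1‖ + ‖Real.sin θ • p.2‖ := norm_add_le _ _
    _ ≤ ‖p‖ + ‖p‖ := add_le_add (norm_smul_le (Real.abs_cos_le_one θ) (norm_fst_le p))
        (norm_smul_le (Real.abs_sin_le_one θ) (norm_snd_le p))
    _ = 2 * ‖p‖ := (two_mul _).symm

theorem hasTemperateGrowth_comp_rotation {f : E → ℝ} (hf : f.HasTemperateGrowth) (θ : ℝ) :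
    (fun p : E × E => f (rotation θ p)).HasTemperateGrowth := by
  have h : (fun p : E × E => Real.cos θ • p.1 + Real.sin θ • p.2).HasTemperateGrowth := by fun_prop
  exact hf.comp h

variable [MeasurableSpace E] [BorelSpace E] {μ ν : Measure E} [IsGaussian μ] [IsGaussian ν]

theorem covariance_dual_rotation (L M : StrongDual ℝ E) (φ θ : ℝ) :
    cov[fun p => L (rotation φ p), fun p => M (rotation θ p); μ.prod ν] =
      Real.cos φ * Real.cos θ * cov[L, M; μ] + Real.sin φ * Real.sin θ * cov[L, M; ν] := by
  have memLp_mul (ρ : Measure E) [IsGaussian ρ] (N : StrongDual ℝ E) (c : ℝ) :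
      MemLp (fun z => c * N z) 2 ρ :=
    (IsGaussian.memLp_dual ρ N 2 (by simp)).const_mul c
  simp only [rotation_apply, map_add, map_smul, smul_eq_mul]
  rw [covariance_fst_add_snd_prod (memLp_mul μ L _) (memLp_mul μ M _) (memLp_mul ν L _)
    (memLp_mul ν M _)]
  simp only [covariance_const_mul_left, covariance_const_mul_right]
  ring

variable [SecondCountableTopology E]

theorem integral_dual_rotation {L : StrongDual ℝ E} (hμ : μ[L] = 0) (hν : ν[L] = 0) (θ : ℝ) :
    ∫ p, L (rotation θ p) ∂(μ.prod ν) = 0 := by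
  have h_fst := (IsGaussian.integrable_dual μ L).comp_fst ν
  have h_snd := (IsGaussian.integrable_dual ν L).comp_snd μ
  simp only [rotation_apply, map_add, map_smul, smul_eq_mul]
  rw [integral_add (h_fst.const_mul _) (h_snd.const_mul _), integral_const_mul,
    integral_const_mul, integral_fun_fst, integral_fun_snd, hμ, hν, smul_zero, smul_zero,
    mul_zero, mul_zero, add_zero]

theorem hasDerivAt_integral_comp_rotation [CompleteSpace E] (ρ : Measure (E × E))
    [IsGaussian ρ] {f : E → ℝ} (hf : f.HasTemperateGrowth) (θ : ℝ) :
    HasDerivAt (fun s => ∫ p, f (rotation s p) ∂ρ)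
      (∫ p, fderiv ℝ f (rotation θ p) (rotation (θ + Real.pi / 2) p) ∂ρ) θ := by
  obtain ⟨k, C, hC⟩ := (hasTemperateGrowth_fderiv hf).2 0
  simp only [norm_iteratedFDeriv_zero] at hC
  have hC0 : 0 ≤ C := by simpa using (norm_nonneg _).trans (hC 0)
  have hcont : Continuous fun p : E × E => fderiv ℝ f (rotation θ p) :=
    (hf.1.continuous_fderiv (by simp)).comp (rotation θ).continuous
  have hbound (s : ℝ) (p : E × E) :
      ‖fderiv ℝ f (rotation s p) (rotation (s + Real.pi / 2) p)‖ ≤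
        C * 2 ^ (k + 1) * (1 + ‖p‖) ^ (k + 1) := by
    calc ‖fderiv ℝ f (rotation s p) (rotation (s + Real.pi / 2) p)‖
        ≤ C * (1 + ‖rotation s p‖) ^ k * ‖rotation (s + Real.pi / 2) p‖ :=
          (fderiv ℝ f (rotation s p)).le_of_opNorm_le (hC _) _
      _ ≤ C * (2 * (1 + ‖p‖)) ^ k * (2 * (1 + ‖p‖)) := by
          gcongr <;> linarith [norm_rotation_le s p, norm_rotation_le (s + Real.pi / 2) p]
      _ = C * 2 ^ (k + 1) * (1 + ‖p‖) ^ (k + 1) := by rw [mul_pow]; ring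
  exact (hasDerivAt_integral_of_dominated_loc_of_deriv_le univ_mem
    (Eventually.of_forall fun s =>
      (hf.1.continuous.comp (rotation s).continuous).aestronglyMeasurable)
    (integrable_of_hasTemperateGrowth ρ (hasTemperateGrowth_comp_rotation hf θ))
    (hcont.clm_apply (rotation _).continuous).aestronglyMeasurable
    (ae_of_all ρ fun p s _ => hbound s p)
    ((integrable_one_add_norm_pow ρ (k + 1)).const_mul _)
    (ae_of_all ρ fun p s _ =>
      (hf.1.differentiable (by simp) _).hasFDerivAt.comp_hasDerivAt s
        (hasDerivAt_rotation s p))).2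

end Interpolation

section Comparison

variable {κ : Type*} [Fintype κ] [DecidableEq κ] {μ ν : Measure (κ → ℝ)} [IsGaussian μ]
  [IsGaussian ν]

theorem clm_apply_eq_sum (T : (κ → ℝ) →L[ℝ] ℝ) (v : κ → ℝ) :
    T v = ∑ a, v a * T (Pi.single a 1) := by
  conv_lhs => rw [pi_eq_sum_univ' v]
  simp only [map_sum, map_smul, smul_eq_mul]

theorem integral_eval_rotation_mul (hμ : ∀ a, ∫ z, z a ∂μ = 0)
    (hν : ∀ a, ∫ z, z a ∂ν = 0) {f : (κ → ℝ) → ℝ} (hf : f.HasTemperateGrowth) (θ : ℝ) (a : κ) :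
    ∫ p, rotation (θ + Real.pi / 2) p a * f (rotation θ p) ∂(μ.prod ν) =
      Real.sin θ * Real.cos θ *
        ∑ b, (cov[fun z => z a, fun z => z b; ν] - cov[fun z => z a, fun z => z b; μ]) *
          ∫ p, fderiv ℝ f (rotation θ p) (Pi.single b 1) ∂(μ.prod ν) := by
  set eval : κ → StrongDual ℝ (κ → ℝ) := ContinuousLinearMap.proj
  set L := eval a ∘L rotation (θ + Real.pi / 2)
  have hL : ∫ p, L p ∂(μ.prod ν) = 0 := integral_dual_rotation (L := eval a) (hμ a) (hν a) _
  have h_chain (p : (κ → ℝ) × (κ → ℝ)) :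
      fderiv ℝ (fun q => f (rotation θ q)) p = fderiv ℝ f (rotation θ p) ∘L rotation θ :=
    have h_rotation : HasFDerivAt (fun q : (κ → ℝ) × (κ → ℝ) => rotation θ q) (rotation θ) p :=
      ContinuousLinearMap.hasFDerivAt (rotation (E := κ → ℝ) θ)
    (HasFDerivAt.comp (g := f) p (hf.1.differentiable (by simp) _).hasFDerivAt h_rotation).fderiv
  have h_cov (b : κ) : rotation θ (covarianceOperator (μ.prod ν) L) b =
      Real.sin θ * Real.cos θ *
        (cov[fun z => z a, fun z => z b; ν] - cov[fun z => z a, fun z => z b; μ]) := by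
    refine (dual_covarianceOperator _ L (eval b ∘L rotation θ)).trans
      ((covariance_dual_rotation (eval a) (eval b) _ θ).trans ?_)
    rw [Real.cos_add_pi_div_two, Real.sin_add_pi_div_two]
    change _ * _ * cov[fun z => z a, fun z => z b; μ] +
      _ * _ * cov[fun z => z a, fun z => z b; ν] = _
    ring
  calc ∫ p, rotation (θ + Real.pi / 2) p a * f (rotation θ p) ∂(μ.prod ν)
      = ∫ p, (L p - (μ.prod ν)[L]) * f (rotation θ p) ∂(μ.prod ν) := by
        rw [hL]
        simp only [sub_zero]
        rfl
    _ = ∫ p, ∑ b, rotation θ (covarianceOperator (μ.prod ν) L) b *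
          fderiv ℝ f (rotation θ p) (Pi.single b 1) ∂(μ.prod ν) := by
        rw [integral_dual_sub_mul_eq_integral_fderiv _ _ (hasTemperateGrowth_comp_rotation hf θ)]
        simp only [h_chain, ContinuousLinearMap.comp_apply]
        simp only [← clm_apply_eq_sum]
    _ = _ := by
        rw [integral_finsetSum _ fun b _ => (integrable_of_hasTemperateGrowth _
          (hasTemperateGrowth_comp_rotation (hasTemperateGrowth_fderiv_apply hf _) θ)).const_mul _,
          Finset.mul_sum]
        simp only [integral_const_mul, h_cov, mul_assoc]

theorem deriv_integral_comp_rotation (hμ : ∀ a, ∫ z, z a ∂μ = 0)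
    (hν : ∀ a, ∫ z, z a ∂ν = 0) {f : (κ → ℝ) → ℝ} (hf : f.HasTemperateGrowth) (θ : ℝ) :
    deriv (fun s => ∫ p, f (rotation s p) ∂(μ.prod ν)) θ =
      Real.sin θ * Real.cos θ * ∑ a, ∑ b,
        (cov[fun z => z a, fun z => z b; ν] - cov[fun z => z a, fun z => z b; μ]) *
          ∫ p, fderiv ℝ (fun z => fderiv ℝ f z (Pi.single a 1)) (rotation θ p) (Pi.single b 1)
            ∂(μ.prod ν) := by
  have h_int (a : κ) : Integrable (fun p : (κ → ℝ) × (κ → ℝ) => rotation (θ + Real.pi / 2) p a *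
      fderiv ℝ f (rotation θ p) (Pi.single a 1)) (μ.prod ν) :=
    integrable_of_hasTemperateGrowth _
      ((hasTemperateGrowth_comp_rotation (hasTemperateGrowth_eval a) _).fun_mul
        (hasTemperateGrowth_comp_rotation (hasTemperateGrowth_fderiv_apply hf _) θ))
  rw [(hasDerivAt_integral_comp_rotation (μ.prod ν) hf θ).deriv]
  simp only [clm_apply_eq_sum (fderiv ℝ f _) (rotation _ _)]
  rw [integral_finsetSum _ fun a _ => h_int a, Finset.mul_sum]
  simp only [integral_eval_rotation_mul hμ hν (hasTemperateGrowth_fderiv_apply hf _)]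

theorem integral_le_integral_of_covariance_sub_mul_nonneg (hμ : ∀ a, ∫ z, z a ∂μ = 0)
    (hν : ∀ a, ∫ z, z a ∂ν = 0) {f : (κ → ℝ) → ℝ} (hf : f.HasTemperateGrowth)
    (hcov : ∀ a b z, 0 ≤ (cov[fun z => z a, fun z => z b; ν] - cov[fun z => z a, fun z => z b; μ]) *
      fderiv ℝ (fun z => fderiv ℝ f z (Pi.single a 1)) z (Pi.single b 1)) :
    ∫ z, f z ∂μ ≤ ∫ z, f z ∂ν := by
  set φ : ℝ → ℝ := fun θ => ∫ p, f (rotation θ p) ∂(μ.prod ν)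
  have hφ (θ : ℝ) := hasDerivAt_integral_comp_rotation (μ.prod ν) hf θ
  have h_mono : MonotoneOn φ (Set.Icc 0 (Real.pi / 2)) := by
    refine monotoneOn_of_deriv_nonneg (convex_Icc _ _)
      (fun θ _ => (hφ θ).continuousAt.continuousWithinAt)
      (fun θ _ => (hφ θ).differentiableAt.differentiableWithinAt) fun θ hθ => ?_
    rw [interior_Icc] at hθ
    rw [deriv_integral_comp_rotation hμ hν hf]
    have h_sin := Real.sin_nonneg_of_nonneg_of_le_pi hθ.1.le (by linarith [hθ.2, Real.pi_pos])
    have h_cos := Real.cos_nonneg_of_mem_Icc ⟨by linarith [hθ.1, Real.pi_pos], hθ.2.le⟩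
    refine mul_nonneg (mul_nonneg h_sin h_cos)
      (Finset.sum_nonneg fun a _ => Finset.sum_nonneg fun b _ => ?_)
    rw [← integral_const_mul]
    exact integral_nonneg fun p => hcov a b _
  have h_zero : φ 0 = ∫ z, f z ∂μ := by
    simp [φ, rotation_apply, integral_fun_fst]
  have h_pi_div_two : φ (Real.pi / 2) = ∫ z, f z ∂ν := by
    simp [φ, rotation_apply, integral_fun_snd]
  rw [← h_zero, ← h_pi_div_two]
  exact h_mono ⟨le_rfl, by positivity⟩ ⟨by positivity, le_rfl⟩ (by positivity)

end Comparison

section Gordon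

/-- A smooth nonincreasing function equal to `1` on `(-∞, l]` and to `0` on `[l', ∞)`, for
`l < l'`. -/
noncomputable def smoothCutoff (l l' t : ℝ) : ℝ := Real.smoothTransition ((l' - t) / (l' - l))

theorem smoothCutoff_nonneg (l l' t : ℝ) : 0 ≤ smoothCutoff l l' t :=
  Real.smoothTransition.nonneg _

theorem smoothCutoff_le_one (l l' t : ℝ) : smoothCutoff l l' t ≤ 1 :=
  Real.smoothTransition.le_one _

theorem smoothCutoff_of_le {l l' t : ℝ} (hl : l < l') (ht : t ≤ l) : smoothCutoff l l' t = 1 :=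
  Real.smoothTransition.one_of_one_le ((one_le_div (sub_pos.2 hl)).2 (by linarith))

theorem smoothCutoff_of_ge {l l' t : ℝ} (hl : l ≤ l') (ht : l' ≤ t) : smoothCutoff l l' t = 0 :=
  Real.smoothTransition.zero_of_nonpos
    (div_nonpos_of_nonpos_of_nonneg (by linarith) (sub_nonneg.2 hl))

theorem smoothCutoff_antitone {l l' : ℝ} (hl : l ≤ l') : Antitone (smoothCutoff l l') :=
  fun _ _ hst => Real.smoothTransition.monotone
    (div_le_div_of_nonneg_right (by linarith) (sub_nonneg.2 hl))

theorem hasTemperateGrowth_smoothTransition : Real.smoothTransition.HasTemperateGrowth := by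
  have h_smooth : ContDiff ℝ (⊤ : ℕ∞) Real.smoothTransition := Real.smoothTransition.contDiff
  have h_support : HasCompactSupport (fderiv ℝ Real.smoothTransition) := by
    refine HasCompactSupport.intro (isCompact_Icc (a := (0 : ℝ)) (b := 1)) fun x hx => ?_
    rcases lt_or_gt_of_ne (fun h : x = 0 => hx (by simp [h])) with h | h
    · have : Real.smoothTransition =ᶠ[𝓝 x] fun _ => 0 := by
        filter_upwards [Iio_mem_nhds h] with y hy
        exact Real.smoothTransition.zero_of_nonpos (le_of_lt hy)
      rw [this.fderiv_eq, fderiv_fun_const, Pi.zero_apply]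
    · have h1 : 1 < x := not_le.1 fun h1 => hx ⟨h.le, h1⟩
      have : Real.smoothTransition =ᶠ[𝓝 x] fun _ => 1 := by
        filter_upwards [Ioi_mem_nhds h1] with y hy
        exact Real.smoothTransition.one_of_one_le (le_of_lt hy)
      rw [this.fderiv_eq, fderiv_fun_const, Pi.zero_apply]
  refine .of_fderiv (h_support.hasTemperateGrowth (h_smooth.fderiv_right le_rfl))
    (h_smooth.differentiable (by simp)) (k := 0) (C := 1) fun x => ?_
  rw [Real.norm_of_nonneg (Real.smoothTransition.nonneg x), pow_zero, mul_one]
  exact Real.smoothTransition.le_one x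

theorem hasTemperateGrowth_smoothCutoff (l l' : ℝ) : (smoothCutoff l l').HasTemperateGrowth := by
  have h_affine : (fun t : ℝ => (l' - t) / (l' - l)).HasTemperateGrowth := by
    simp only [div_eq_mul_inv]
    fun_prop
  exact hasTemperateGrowth_smoothTransition.comp h_affine

theorem fderiv_fderiv_apply_nonneg_of_supermodular {E : Type*} [NormedAddCommGroup E]
    [NormedSpace ℝ E] {f : E → ℝ} (hf : ContDiff ℝ 2 f) {u v : E}
    (h : ∀ z (s t : ℝ), 0 ≤ s → 0 ≤ t →
      f (z + s • u) + f (z + t • v) ≤ f (z + s • u + t • v) + f z) (z : E) :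
    0 ≤ fderiv ℝ (fun w => fderiv ℝ f w u) z v := by
  have hf_line (w : E) : HasLineDerivAt ℝ f (fderiv ℝ f w u) w u :=
    (hf.differentiable (by simp) w).hasFDerivAt.hasLineDerivAt u
  have h_fderiv_mono (w : E) {t : ℝ} (ht : 0 ≤ t) :
      fderiv ℝ f w u ≤ fderiv ℝ f (w + t • v) u := by
    refine sub_nonneg.1 ((HasDerivAt.sub (hf_line (w + t • v)) (hf_line w)).nonneg_of_monotone
      fun s s' hs => ?_)
    have := h (w + s • u) (s' - s) t (sub_nonneg.2 hs) ht
    rw [add_assoc w, ← add_smul, add_sub_cancel] at this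
    simp only [Pi.sub_apply, add_right_comm w (t • v)]
    linarith
  have hf' : DifferentiableAt ℝ (fun w => fderiv ℝ f w u) z :=
    ((hf.fderiv_right (m := 1) le_rfl).clm_apply contDiff_const).differentiable (by simp) z
  refine (hf'.hasFDerivAt.hasLineDerivAt v).nonneg_of_monotone fun t t' ht => ?_
  have := h_fderiv_mono (z + t • v) (sub_nonneg.2 ht)
  rwa [add_assoc, ← add_smul, add_sub_cancel] at this

variable {X Y : Type*}

section Blocks

variable [Fintype X] {ψ : X → (Y → ℝ) → ℝ}

theorem hasTemperateGrowth_prod_block [Fintype Y] (hψ : ∀ x, (ψ x).HasTemperateGrowth) :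
    (fun z : X × Y → ℝ => ∏ x, ψ x fun y => z (x, y)).HasTemperateGrowth := by
  refine hasTemperateGrowth_finset_prod _ fun x _ => (hψ x).comp ?_
  exact (ContinuousLinearMap.pi fun y =>
    ContinuousLinearMap.proj (R := ℝ) (φ := fun _ : X × Y => ℝ) (x, y)).hasTemperateGrowth

theorem prod_block_supermodular [DecidableEq X] [DecidableEq Y] (hψ_mono : ∀ x, Monotone (ψ x))
    (hψ_nonneg : ∀ x w, 0 ≤ ψ x w) {a b : X × Y} (hab : a.1 ≠ b.1) (z : X × Y → ℝ) {s t : ℝ}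
    (hs : 0 ≤ s) (ht : 0 ≤ t) :
    (∏ x, ψ x fun y => (z + s • (Pi.single a 1 : X × Y → ℝ)) (x, y)) +
        ∏ x, ψ x (fun y => (z + t • (Pi.single b 1 : X × Y → ℝ)) (x, y)) ≤
      (∏ x, ψ x fun y =>
        (z + s • (Pi.single a 1 : X × Y → ℝ) + t • (Pi.single b 1 : X × Y → ℝ)) (x, y)) +
        ∏ x, ψ x fun y => z (x, y) := by
  have h_single_nonneg (c : X × Y) : 0 ≤ (Pi.single c 1 : X × Y → ℝ) :=
    Pi.single_nonneg.2 zero_le_one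
  have h_block {r : ℝ} {c : X × Y} {x : X} (hx : x ≠ c.1) (w : X × Y → ℝ) :
      (fun y => (w + r • (Pi.single c 1 : X × Y → ℝ)) (x, y)) = fun y => w (x, y) := by
    ext y
    have hc : (x, y) ≠ c := fun h => hx (congrArg Prod.fst h)
    simp [Pi.single_eq_of_ne hc]
  have h_rest (w : X × Y → ℝ) : ∏ x ∈ Finset.univ.erase a.1,
      ψ x (fun y => (w + s • (Pi.single a 1 : X × Y → ℝ)) (x, y)) =
        ∏ x ∈ Finset.univ.erase a.1, ψ x fun y => w (x, y) :=
    Finset.prod_congr rfl fun x hx => by rw [h_block (Finset.ne_of_mem_erase hx)]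
  have h_factor_mono : ψ a.1 (fun y => z (a.1, y)) ≤
      ψ a.1 fun y => (z + s • (Pi.single a 1 : X × Y → ℝ)) (a.1, y) :=
    hψ_mono _ fun y => le_add_of_nonneg_right (mul_nonneg hs (h_single_nonneg a _))
  have h_rest_mono : ∏ x ∈ Finset.univ.erase a.1, ψ x (fun y => z (x, y)) ≤
      ∏ x ∈ Finset.univ.erase a.1, ψ x fun y => (z + t • (Pi.single b 1 : X × Y → ℝ)) (x, y) :=
    Finset.prod_le_prod (fun x _ => hψ_nonneg x _) fun x _ => hψ_mono _ fun y =>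
      le_add_of_nonneg_right (mul_nonneg ht (h_single_nonneg b _))
  simp only [← Finset.mul_prod_erase Finset.univ _ (Finset.mem_univ a.1)]
  rw [h_block hab, h_block hab, h_rest, add_right_comm z, h_rest]
  nlinarith [mul_nonneg (sub_nonneg.2 h_factor_mono) (sub_nonneg.2 h_rest_mono)]

theorem integral_prod_block_le_of_covariance [Fintype Y] {μ ν : Measure (X × Y → ℝ)} [IsGaussian μ]
    [IsGaussian ν] (hμ : ∀ a, ∫ z, z a ∂μ = 0) (hν : ∀ a, ∫ z, z a ∂ν = 0)
    (h_block : ∀ x y y', cov[fun z => z (x, y), fun z => z (x, y'); μ] =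
      cov[fun z => z (x, y), fun z => z (x, y'); ν])
    (h_cov : ∀ a b, cov[fun z => z a, fun z => z b; μ] ≤ cov[fun z => z a, fun z => z b; ν])
    (hψ : ∀ x, (ψ x).HasTemperateGrowth) (hψ_mono : ∀ x, Monotone (ψ x))
    (hψ_nonneg : ∀ x w, 0 ≤ ψ x w) :
    ∫ z, ∏ x, ψ x (fun y => z (x, y)) ∂μ ≤ ∫ z, ∏ x, ψ x (fun y => z (x, y)) ∂ν := by
  classical
  have h_growth := hasTemperateGrowth_prod_block hψ
  refine integral_le_integral_of_covariance_sub_mul_nonneg hμ hν h_growth fun a b z => ?_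
  by_cases hab : a.1 = b.1
  · obtain ⟨x, y⟩ := a
    obtain ⟨x', y'⟩ := b
    obtain rfl : x = x' := hab
    rw [h_block, sub_self, zero_mul]
  · exact mul_nonneg (sub_nonneg.2 (h_cov a b)) (fderiv_fderiv_apply_nonneg_of_supermodular
      (h_growth.1.of_le ENat.LEInfty.out)
      (fun w _ _ => prod_block_supermodular hψ_mono hψ_nonneg hab w) z)

end Blocks

section Cutoff

variable [Fintype X] [Fintype Y]

/-- A smooth substitute for the indicator of the complement of `{w | ∀ y, w y ≤ l}`, to which the
comparison of Gaussian integrals applies: it vanishes on that set and equals `1` as soon as some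
coordinate of `w` is at least `l'`. -/
noncomputable def blockCutoff (l l' : ℝ) (w : Y → ℝ) : ℝ := 1 - ∏ y, smoothCutoff l l' (w y)

theorem blockCutoff_nonneg (l l' : ℝ) (w : Y → ℝ) : 0 ≤ blockCutoff l l' w :=
  sub_nonneg.2 (Finset.prod_le_one (fun _ _ => smoothCutoff_nonneg _ _ _)
    fun _ _ => smoothCutoff_le_one _ _ _)

theorem blockCutoff_le_one (l l' : ℝ) (w : Y → ℝ) : blockCutoff l l' w ≤ 1 :=
  sub_le_self _ (Finset.prod_nonneg fun _ _ => smoothCutoff_nonneg _ _ _)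

theorem blockCutoff_monotone {l l' : ℝ} (hl : l ≤ l') :
    Monotone (blockCutoff l l' : (Y → ℝ) → ℝ) :=
  fun _ _ h => sub_le_sub_left (Finset.prod_le_prod (fun _ _ => smoothCutoff_nonneg _ _ _)
    fun y _ => smoothCutoff_antitone hl (h y)) _

theorem blockCutoff_of_forall_le {l l' : ℝ} (hl : l < l') {w : Y → ℝ} (hw : ∀ y, w y ≤ l) :
    blockCutoff l l' w = 0 := by
  rw [blockCutoff, Finset.prod_eq_one fun y _ => smoothCutoff_of_le hl (hw y), sub_self]

theorem blockCutoff_of_exists_ge {l l' : ℝ} (hl : l ≤ l') {w : Y → ℝ} (hw : ∃ y, l' ≤ w y) :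
    blockCutoff l l' w = 1 := by
  obtain ⟨y, hy⟩ := hw
  rw [blockCutoff, Finset.prod_eq_zero (Finset.mem_univ y) (smoothCutoff_of_ge hl hy), sub_zero]

theorem hasTemperateGrowth_blockCutoff (l l' : ℝ) :
    (blockCutoff l l' : (Y → ℝ) → ℝ).HasTemperateGrowth := by
  have h_prod : (fun w : Y → ℝ => ∏ y, smoothCutoff l l' (w y)).HasTemperateGrowth :=
    hasTemperateGrowth_finset_prod _ fun y _ =>
      (hasTemperateGrowth_smoothCutoff l l').comp (hasTemperateGrowth_eval y)
  unfold blockCutoff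
  fun_prop

theorem integrable_prod_blockCutoff (μ : Measure (X × Y → ℝ)) [IsFiniteMeasure μ] (l l' : ℝ) :
    Integrable (fun z => ∏ x, blockCutoff l l' fun y => z (x, y)) μ := by
  have h_growth :
      (fun z : X × Y → ℝ => ∏ x, blockCutoff l l' fun y => z (x, y)).HasTemperateGrowth :=
    hasTemperateGrowth_prod_block fun _ => hasTemperateGrowth_blockCutoff l l'
  refine (integrable_const (1 : ℝ)).mono' h_growth.1.continuous.aestronglyMeasurable
    (ae_of_all _ fun z => ?_)
  rw [Real.norm_of_nonneg (Finset.prod_nonneg fun _ _ => blockCutoff_nonneg _ _ _)]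
  exact Finset.prod_le_one (fun _ _ => blockCutoff_nonneg _ _ _) fun _ _ => blockCutoff_le_one _ _ _

theorem integral_prod_blockCutoff_le (μ : Measure (X × Y → ℝ)) [IsFiniteMeasure μ] {l l' : ℝ}
    (hl : l < l') :
    ∫ z, ∏ x, blockCutoff l l' (fun y => z (x, y)) ∂μ ≤
      μ.real {z | ∃ x, ∀ y, z (x, y) ≤ l}ᶜ := by
  have h_meas : MeasurableSet {z : X × Y → ℝ | ∃ x, ∀ y, z (x, y) ≤ l} := by measurability
  rw [← integral_indicator_one h_meas.compl]
  refine integral_mono (integrable_prod_blockCutoff μ l l')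
    ((integrable_const (1 : ℝ)).indicator h_meas.compl) fun z => ?_
  by_cases hz : ∃ x, ∀ y, z (x, y) ≤ l
  · obtain ⟨x, hx⟩ := id hz
    rw [Set.indicator_of_notMem (by simpa using hz)]
    exact (Finset.prod_eq_zero (Finset.mem_univ x) (blockCutoff_of_forall_le hl hx)).le
  · rw [Set.indicator_of_mem (by exact hz)]
    exact Finset.prod_le_one (fun _ _ => blockCutoff_nonneg _ _ _)
      fun _ _ => blockCutoff_le_one _ _ _

theorem le_integral_prod_blockCutoff (μ : Measure (X × Y → ℝ)) [IsFiniteMeasure μ] {l l' : ℝ}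
    (hl : l ≤ l') :
    μ.real {z | ∃ x, ∀ y, z (x, y) < l'}ᶜ ≤
      ∫ z, ∏ x, blockCutoff l l' (fun y => z (x, y)) ∂μ := by
  have h_meas : MeasurableSet {z : X × Y → ℝ | ∃ x, ∀ y, z (x, y) < l'} := by measurability
  rw [← integral_indicator_one h_meas.compl]
  refine integral_mono ((integrable_const (1 : ℝ)).indicator h_meas.compl)
    (integrable_prod_blockCutoff μ l l') fun z => ?_
  by_cases hz : ∃ x, ∀ y, z (x, y) < l'
  · rw [Set.indicator_of_notMem (by simpa using hz)]
    exact Finset.prod_nonneg fun _ _ => blockCutoff_nonneg _ _ _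
  · rw [Set.indicator_of_mem (by exact hz)]
    push Not at hz
    exact (Finset.prod_eq_one fun x _ => blockCutoff_of_exists_ge hl (hz x)).ge

end Cutoff

theorem gordon_comparison [Finite X] [Finite Y] {Ω Ω' : Type*} [MeasurableSpace Ω]
    [MeasurableSpace Ω'] {P : Measure Ω} {P' : Measure Ω'} {U : X × Y → Ω → ℝ} {V : X × Y → Ω' → ℝ}
    (hU : HasGaussianLaw (fun ω a => U a ω) P) (hV : HasGaussianLaw (fun ω a => V a ω) P')
    (hU_mean : ∀ a, P[U a] = 0) (hV_mean : ∀ a, P'[V a] = 0)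
    (h_block : ∀ x y y', cov[V (x, y), V (x, y'); P'] = cov[U (x, y), U (x, y'); P])
    (h_cov : ∀ a b, cov[V a, V b; P'] ≤ cov[U a, U b; P]) {l l' : ℝ} (hl : l < l') :
    P {ω | ∃ x, ∀ y, U (x, y) ω ≤ l} ≤ P' {ω | ∃ x, ∀ y, V (x, y) ω < l'} := by
  have := Fintype.ofFinite X
  have := Fintype.ofFinite Y
  set μ := P.map fun ω a => U a ω
  set ν := P'.map fun ω a => V a ω
  have : IsGaussian μ := hU.isGaussian_map
  have : IsGaussian ν := hV.isGaussian_map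
  have mean_μ (a : X × Y) : ∫ z, z a ∂μ = 0 := by
    rw [integral_map hU.aemeasurable (measurable_pi_apply a).aestronglyMeasurable, hU_mean]
  have mean_ν (a : X × Y) : ∫ z, z a ∂ν = 0 := by
    rw [integral_map hV.aemeasurable (measurable_pi_apply a).aestronglyMeasurable, hV_mean]
  have cov_μ (a b : X × Y) : cov[fun z => z a, fun z => z b; μ] = cov[U a, U b; P] :=
    covariance_map_fun (measurable_pi_apply a).aestronglyMeasurable
      (measurable_pi_apply b).aestronglyMeasurable hU.aemeasurable
  have cov_ν (a b : X × Y) : cov[fun z => z a, fun z => z b; ν] = cov[V a, V b; P'] :=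
    covariance_map_fun (measurable_pi_apply a).aestronglyMeasurable
      (measurable_pi_apply b).aestronglyMeasurable hV.aemeasurable
  have h_meas : MeasurableSet {z : X × Y → ℝ | ∃ x, ∀ y, z (x, y) ≤ l} := by measurability
  have h_meas' : MeasurableSet {z : X × Y → ℝ | ∃ x, ∀ y, z (x, y) < l'} := by measurability
  have h_compl : ν.real {z | ∃ x, ∀ y, z (x, y) < l'}ᶜ ≤ μ.real {z | ∃ x, ∀ y, z (x, y) ≤ l}ᶜ :=
    (le_integral_prod_blockCutoff ν hl.le).trans <|
      (integral_prod_block_le_of_covariance mean_ν mean_μ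
        (fun x y y' => by rw [cov_ν, cov_μ, h_block])
        (fun a b => by rw [cov_ν, cov_μ]; exact h_cov a b)
        (fun _ => hasTemperateGrowth_blockCutoff l l') (fun _ => blockCutoff_monotone hl.le)
        fun _ _ => blockCutoff_nonneg _ _ _).trans (integral_prod_blockCutoff_le μ hl)
  have h_le : μ {z | ∃ x, ∀ y, z (x, y) ≤ l} ≤ ν {z | ∃ x, ∀ y, z (x, y) < l'} := by
    rw [probReal_compl_eq_one_sub h_meas, probReal_compl_eq_one_sub h_meas'] at h_compl
    exact (ENNReal.toReal_le_toReal (measure_ne_top _ _) (measure_ne_top _ _)).1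
      ((sub_le_sub_iff_left 1).1 h_compl)
  rwa [Measure.map_apply_of_aemeasurable hU.aemeasurable h_meas,
    Measure.map_apply_of_aemeasurable hV.aemeasurable h_meas'] at h_le

end Gordon

section StandardGaussian

open scoped InnerProductSpace

variable {E F : Type*} [NormedAddCommGroup E] [InnerProductSpace ℝ E] [FiniteDimensional ℝ E]
  [MeasurableSpace E] [BorelSpace E] [NormedAddCommGroup F] [InnerProductSpace ℝ F]
  [FiniteDimensional ℝ F] [MeasurableSpace F] [BorelSpace F]

theorem memLp_inner_stdGaussian (u : E) : MemLp (fun z => ⟪u, z⟫_ℝ) 2 (stdGaussian E) :=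
  IsGaussian.memLp_dual _ (innerSL ℝ u) 2 (by simp)

theorem integral_inner_stdGaussian (u : E) : ∫ z, ⟪u, z⟫_ℝ ∂stdGaussian E = 0 :=
  integral_strongDual_stdGaussian (innerSL ℝ u)

theorem covariance_inner_stdGaussian (u u' : E) :
    cov[fun z => ⟪u, z⟫_ℝ, fun z => ⟪u', z⟫_ℝ; stdGaussian E] = ⟪u, u'⟫_ℝ := by
  have := FiniteDimensional.complete ℝ E
  rw [← covarianceBilin_apply_eq_cov IsGaussian.memLp_two_id, covarianceBilin_stdGaussian,
    innerSL_apply_apply]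

theorem hasGaussianLaw_inner_add_inner {ι : Type*} [Finite ι] (u : ι → E) (v : ι → F) :
    HasGaussianLaw (fun (p : E × F) i => ⟪u i, p.1⟫_ℝ + ⟪v i, p.2⟫_ℝ)
      ((stdGaussian E).prod (stdGaussian F)) := by
  have := Fintype.ofFinite ι
  exact IsGaussian.hasGaussianLaw_id.map_fun (ContinuousLinearMap.pi fun i =>
    innerSL ℝ (u i) ∘L ContinuousLinearMap.fst ℝ E F +
      innerSL ℝ (v i) ∘L ContinuousLinearMap.snd ℝ E F)

theorem integral_inner_add_inner (u : E) (v : F) :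
    ∫ p, (⟪u, p.1⟫_ℝ + ⟪v, p.2⟫_ℝ) ∂(stdGaussian E).prod (stdGaussian F) = 0 := by
  have h_fst := ((memLp_inner_stdGaussian u).integrable one_le_two).comp_fst (stdGaussian F)
  have h_snd := ((memLp_inner_stdGaussian v).integrable one_le_two).comp_snd (stdGaussian E)
  rw [integral_add h_fst h_snd, integral_fun_fst (fun z => ⟪u, z⟫_ℝ),
    integral_fun_snd (fun z => ⟪v, z⟫_ℝ), integral_inner_stdGaussian, integral_inner_stdGaussian,
    smul_zero, smul_zero, add_zero]

theorem covariance_inner_add_inner (u u' : E) (v v' : F) :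
    cov[fun p => ⟪u, p.1⟫_ℝ + ⟪v, p.2⟫_ℝ, fun p => ⟪u', p.1⟫_ℝ + ⟪v', p.2⟫_ℝ;
      (stdGaussian E).prod (stdGaussian F)] = ⟪u, u'⟫_ℝ + ⟪v, v'⟫_ℝ := by
  rw [covariance_fst_add_snd_prod (memLp_inner_stdGaussian u) (memLp_inner_stdGaussian u')
    (memLp_inner_stdGaussian v) (memLp_inner_stdGaussian v'), covariance_inner_stdGaussian,
    covariance_inner_stdGaussian]

theorem measure_stdGaussian_real_Ici_le {δ : ℝ} (hδ : 0 < δ) :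
    stdGaussian ℝ (Set.Ici δ) ≤ ENNReal.ofReal (1 / δ ^ 2) := by
  have h_var : Var[id; stdGaussian ℝ] = 1 := by
    rw [← covariance_self (by fun_prop)]
    simpa [Function.id_def] using covariance_inner_stdGaussian (1 : ℝ) 1
  have h_mean : (stdGaussian ℝ)[id] = 0 := integral_id_stdGaussian
  have h_chebyshev := meas_ge_le_variance_div_sq (IsGaussian.memLp_two_id (μ := stdGaussian ℝ)) hδ
  rw [h_var, h_mean] at h_chebyshev
  refine (measure_mono fun s (hs : δ ≤ s) => ?_).trans h_chebyshev
  rw [Set.mem_ofPred_eq, id, sub_zero]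
  exact hs.trans (le_abs_self s)

end StandardGaussian

section Bilinear

open scoped InnerProductSpace

variable {N R : Type*}

/-- The matrix `y xᵀ`. With matrices regarded as Euclidean vectors, `⟪outer y x, G⟫` is the bilinear
form `yᵀ G x`. -/
def outer (y : EuclideanSpace ℝ R) (x : EuclideanSpace ℝ N) : EuclideanSpace ℝ (R × N) :=
  WithLp.toLp 2 fun p => y p.1 * x p.2

theorem outer_smul_right (y : EuclideanSpace ℝ R) (c : ℝ) (x : EuclideanSpace ℝ N) :
    outer y (c • x) = c • outer y x := by
  ext p
  simp only [outer, PiLp.smul_apply, smul_eq_mul]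
  ring

variable [Fintype N] [Fintype R]

theorem inner_outer (y : EuclideanSpace ℝ R) (x : EuclideanSpace ℝ N)
    (G : EuclideanSpace ℝ (R × N)) : ⟪outer y x, G⟫_ℝ = ∑ r, y r * ∑ j, G (r, j) * x j := by
  simp only [outer, PiLp.inner_apply, RCLike.inner_apply, conj_trivial, Fintype.sum_prod_type,
    Finset.mul_sum]
  exact Finset.sum_congr rfl fun r _ => Finset.sum_congr rfl fun j _ => by ring

theorem inner_outer_outer (y y' : EuclideanSpace ℝ R) (x x' : EuclideanSpace ℝ N) :
    ⟪outer y x, outer y' x'⟫_ℝ = ⟪y, y'⟫_ℝ * ⟪x, x'⟫_ℝ := by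
  simp only [outer, PiLp.inner_apply, RCLike.inner_apply, conj_trivial, Fintype.sum_prod_type,
    Finset.sum_mul_sum]
  exact Finset.sum_congr rfl fun r _ => Finset.sum_congr rfl fun j _ => by ring

theorem gordon_comparison_outer {X Y : Type*} [Finite X] [Finite Y]
    {x : X → EuclideanSpace ℝ N} (hx : ∀ a, ‖x a‖ = 1) {y : Y → EuclideanSpace ℝ R}
    (hy : ∀ b, ‖y b‖ ≤ 1) {l l' : ℝ} (hl : l < l') :
    ((stdGaussian (EuclideanSpace ℝ (R × N))).prod (stdGaussian ℝ))
        {p | ∃ a, ∀ b, ⟪outer (y b) (x a), p.1⟫_ℝ + ⟪1, p.2⟫_ℝ ≤ l} ≤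
      ((stdGaussian (EuclideanSpace ℝ N)).prod (stdGaussian (EuclideanSpace ℝ R)))
        {p | ∃ a, ∀ b, ⟪x a, p.1⟫_ℝ + ⟪y b, p.2⟫_ℝ < l'} := by
  have h_one : ⟪(1 : ℝ), 1⟫_ℝ = 1 := by simp
  refine gordon_comparison
    (hasGaussianLaw_inner_add_inner (fun a : X × Y => outer (y a.2) (x a.1)) fun _ => (1 : ℝ))
    (hasGaussianLaw_inner_add_inner (fun a : X × Y => x a.1) fun a => y a.2)
    (fun _ => integral_inner_add_inner _ _) (fun _ => integral_inner_add_inner _ _)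
    (fun a b b' => ?_) (fun a b => ?_) hl
  · rw [covariance_inner_add_inner, covariance_inner_add_inner, inner_outer_outer, h_one,
      real_inner_self_eq_norm_sq, hx, one_pow, mul_one, add_comm]
  · have hx_le : ⟪x a.1, x b.1⟫_ℝ ≤ 1 := (real_inner_le_norm _ _).trans_eq (by simp [hx])
    have hy_le : ⟪y a.2, y b.2⟫_ℝ ≤ 1 :=
      (real_inner_le_norm _ _).trans (mul_le_one₀ (hy _) (norm_nonneg _) (hy _))
    rw [covariance_inner_add_inner, covariance_inner_add_inner, inner_outer_outer, h_one]
    nlinarith [mul_nonneg (sub_nonneg.2 hx_le) (sub_nonneg.2 hy_le)]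

theorem measure_exists_forall_inner_outer_lt_le_of_finite {X Y : Type*} [Finite X] [Finite Y]
    {x : X → EuclideanSpace ℝ N} (hx : ∀ a, ‖x a‖ = 1) {y : Y → EuclideanSpace ℝ R}
    (hy : ∀ b, ‖y b‖ ≤ 1) {δ : ℝ} (hδ : 0 < δ) (c : ℝ) :
    stdGaussian (EuclideanSpace ℝ (R × N)) {G | ∃ a, ∀ b, ⟪outer (y b) (x a), G⟫_ℝ < δ} ≤
      stdGaussian (EuclideanSpace ℝ N) {g | ∃ a, ⟪x a, g⟫_ℝ < -c} +
        stdGaussian (EuclideanSpace ℝ R) {h | ∀ b, ⟪y b, h⟫_ℝ ≤ c + 3 * δ} +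
        stdGaussian ℝ (Set.Ici δ) := by
  set S : Set (EuclideanSpace ℝ (R × N)) := {G | ∃ a, ∀ b, ⟪outer (y b) (x a), G⟫_ℝ < δ}
  set S_aux := {g : EuclideanSpace ℝ N | ∃ a, ⟪x a, g⟫_ℝ < -c}
  set T_aux := {h : EuclideanSpace ℝ R | ∀ b, ⟪y b, h⟫_ℝ ≤ c + 3 * δ}
  have h_split : Prod.fst ⁻¹' S ⊆
      {p | ∃ a, ∀ b, ⟪outer (y b) (x a), p.1⟫_ℝ + ⟪1, p.2⟫_ℝ ≤ 2 * δ} ∪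
        Prod.snd ⁻¹' (Set.Ici δ) := by
    rintro ⟨G, s⟩ ⟨a, ha⟩
    refine (le_or_gt δ s).elim Or.inr fun hs => Or.inl ⟨a, fun b => ?_⟩
    have h_one : ⟪1, s⟫_ℝ = s := by simp
    linarith [ha b]
  have h_split_aux : {p | ∃ a, ∀ b, ⟪x a, p.1⟫_ℝ + ⟪y b, p.2⟫_ℝ < 3 * δ} ⊆
      Prod.fst ⁻¹' S_aux ∪ Prod.snd ⁻¹' T_aux := by
    rintro ⟨g, h⟩ ⟨a, ha⟩
    refine (lt_or_ge ⟪x a, g⟫_ℝ (-c)).imp (fun hg => ⟨a, hg⟩) fun hg b => ?_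
    linarith [ha b]
  calc stdGaussian _ S
      = ((stdGaussian _).prod (stdGaussian ℝ)) (Prod.fst ⁻¹' S) := by
        rw [← Set.prod_univ, Measure.prod_prod, measure_univ, mul_one]
    _ ≤ ((stdGaussian _).prod (stdGaussian ℝ))
          {p | ∃ a, ∀ b, ⟪outer (y b) (x a), p.1⟫_ℝ + ⟪1, p.2⟫_ℝ ≤ 2 * δ} +
          stdGaussian ℝ (Set.Ici δ) :=
        (measure_mono h_split).trans <| (measure_union_le _ _).trans <|
          add_le_add_right (measurePreserving_snd.measure_preimage_le _) _
    _ ≤ ((stdGaussian _).prod (stdGaussian _))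
          {p | ∃ a, ∀ b, ⟪x a, p.1⟫_ℝ + ⟪y b, p.2⟫_ℝ < 3 * δ} + stdGaussian ℝ (Set.Ici δ) :=
        add_le_add_left (gordon_comparison_outer hx hy (by linarith)) _
    _ ≤ stdGaussian _ S_aux + stdGaussian _ T_aux + stdGaussian ℝ (Set.Ici δ) :=
        add_le_add_left ((measure_mono h_split_aux).trans <| (measure_union_le _ _).trans <|
          add_le_add (measurePreserving_fst.measure_preimage_le _)
            (measurePreserving_snd.measure_preimage_le _)) _

end Bilinear

section Limits

variable {α β : Type*} [TopologicalSpace α] [SecondCountableTopology α] [MeasurableSpace α]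

theorem measure_iUnion_eq_iSup_finset_of_isOpen (μ : Measure α) {U : β → Set α}
    (hU : ∀ b, IsOpen (U b)) : μ (⋃ b, U b) = ⨆ s : Finset β, μ (⋃ b ∈ s, U b) := by
  classical
  refine le_antisymm ?_ (iSup_le fun s => measure_mono (Set.iUnion₂_subset_iUnion _ _))
  obtain ⟨T, hT, hTU⟩ := TopologicalSpace.isOpen_iUnion_countable U hU
  have : Countable T := hT
  have h_directed : Directed (· ⊆ ·) fun s : Finset T => ⋃ b ∈ s, U b :=
    directed_of_isDirected_le fun s s' h => Set.biUnion_subset_biUnion_left h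
  rw [← hTU, Set.biUnion_eq_iUnion, Set.iUnion_eq_iUnion_finset, h_directed.measure_iUnion]
  refine iSup_le fun s => le_iSup_of_le (s.image (↑)) (measure_mono ?_)
  simp only [Finset.set_biUnion_finset_image, subset_rfl]

theorem measure_iInter_eq_iInf_finset_of_isClosed [BorelSpace α] (μ : Measure α)
    [IsFiniteMeasure μ] {C : β → Set α} (hC : ∀ b, IsClosed (C b)) :
    μ (⋂ b, C b) = ⨅ s : Finset β, μ (⋂ b ∈ s, C b) := by
  have h_compl (D : Set α) (hD : IsClosed D) : μ D = μ Set.univ - μ Dᶜ := by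
    rw [measure_compl hD.measurableSet (measure_ne_top _ _),
      ENNReal.sub_sub_cancel (measure_ne_top _ _) (measure_mono (Set.subset_univ _))]
  rw [h_compl _ (isClosed_iInter hC), Set.compl_iInter,
    measure_iUnion_eq_iSup_finset_of_isOpen μ fun b => (hC b).isOpen_compl, ENNReal.sub_iSup
      (measure_ne_top _ _)]
  refine iInf_congr fun s => ?_
  rw [h_compl (⋂ b ∈ s, C b) (isClosed_biInter fun b _ => hC b)]
  simp only [Set.compl_iInter]

end Limits

section Escape

open scoped InnerProductSpace

variable {N R : Type*} [Fintype N] [Fintype R]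

theorem measure_exists_forall_inner_outer_nonpos_le_of_norm_eq_one
    {K : Set (EuclideanSpace ℝ N)} (hK : ∀ x ∈ K, ‖x‖ = 1)
    {T : Set (EuclideanSpace ℝ R)} (hT : ∀ y ∈ T, ‖y‖ ≤ 1) {δ : ℝ} (hδ : 0 < δ) (c : ℝ) :
    stdGaussian (EuclideanSpace ℝ (R × N)) {G | ∃ x ∈ K, ∀ y ∈ T, ⟪outer y x, G⟫_ℝ ≤ 0} ≤
      stdGaussian (EuclideanSpace ℝ N) {g | ∃ x ∈ K, ⟪x, g⟫_ℝ < -c} +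
        stdGaussian (EuclideanSpace ℝ R) {h | ∀ y ∈ T, ⟪y, h⟫_ℝ ≤ c + 3 * δ} +
        stdGaussian ℝ (Set.Ici δ) := by
  have h_iInter : {h : EuclideanSpace ℝ R | ∀ y ∈ T, ⟪y, h⟫_ℝ ≤ c + 3 * δ} =
      ⋂ y : T, {h | ⟪(y : EuclideanSpace ℝ R), h⟫_ℝ ≤ c + 3 * δ} := by
    ext h
    simp only [Set.mem_ofPred_eq, Set.mem_iInter, Subtype.forall]
  rw [h_iInter, measure_iInter_eq_iInf_finset_of_isClosed _ fun y : T =>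
    isClosed_le (by fun_prop) continuous_const, ENNReal.add_iInf, ENNReal.iInf_add]
  refine le_iInf fun t => ?_
  set U : K → Set (EuclideanSpace ℝ (R × N)) := fun x =>
    ⋂ y ∈ t, {G | ⟪outer (y : EuclideanSpace ℝ R) (x : EuclideanSpace ℝ N), G⟫_ℝ < δ}
  have hU_open (x : K) : IsOpen (U x) :=
    isOpen_biInter_finset fun y _ => isOpen_lt (by fun_prop) continuous_const
  have h_subset : {G | ∃ x ∈ K, ∀ y ∈ T, ⟪outer y x, G⟫_ℝ ≤ 0} ⊆ ⋃ x, U x :=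
    fun G ⟨x, hx, hG⟩ => Set.mem_iUnion.2
      ⟨⟨x, hx⟩, Set.mem_iInter₂.2 fun y _ => (hG y y.2).trans_lt hδ⟩
  refine (measure_mono h_subset).trans ?_
  rw [measure_iUnion_eq_iSup_finset_of_isOpen _ hU_open]
  refine iSup_le fun s => ?_
  have h_finite := measure_exists_forall_inner_outer_lt_le_of_finite
    (x := fun a : s => (a : EuclideanSpace ℝ N)) (fun a => hK _ a.1.2)
    (y := fun b : t => (b : EuclideanSpace ℝ R)) (fun b => hT _ b.1.2) hδ c
  refine (measure_mono fun G hG => ?_).trans (h_finite.trans ?_)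
  · obtain ⟨x, hx, hG⟩ := Set.mem_iUnion₂.1 hG
    exact ⟨⟨x, hx⟩, fun y => Set.mem_iInter₂.1 hG y y.2⟩
  · gcongr
    · exact fun ⟨a, ha⟩ => ⟨a, a.1.2, ha⟩
    · exact fun h hh => Set.mem_iInter₂.2 fun y hy => hh ⟨y, hy⟩

/-- The directions `g` in which some nonzero `x ∈ S` satisfies `gᵀ x + ‖x‖ c ≤ 0` strictly. The
strictness makes this set open; the clause `x = 0` makes it everything when `0 ∈ S`, since `0`
satisfies the constraint for every `g`. -/
def hitSet (S : Set (EuclideanSpace ℝ N)) (c : ℝ) : Set (EuclideanSpace ℝ N) :=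
  {g | ∃ x ∈ S, x = 0 ∨ ⟪x, g⟫_ℝ + ‖x‖ * c < 0}

theorem isOpen_hitSet (S : Set (EuclideanSpace ℝ N)) (c : ℝ) : IsOpen (hitSet S c) := by
  have h_iUnion : hitSet S c = ⋃ x ∈ S, {g | x = 0 ∨ ⟪x, g⟫_ℝ + ‖x‖ * c < 0} := by
    ext g
    simp only [hitSet, Set.mem_ofPred_eq, Set.mem_iUnion, exists_prop]
  rw [h_iUnion]
  exact isOpen_biUnion fun x _ => isOpen_const.union <|
    isOpen_lt (f := fun g => ⟪x, g⟫_ℝ + ‖x‖ * c) (by fun_prop) continuous_const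

theorem hitSet_mono {S S' : Set (EuclideanSpace ℝ N)} (h : S ⊆ S') (c : ℝ) :
    hitSet S c ⊆ hitSet S' c :=
  fun _ ⟨x, hx, hg⟩ => ⟨x, h hx, hg⟩

theorem hitSet_eq_univ {S : Set (EuclideanSpace ℝ N)} (h : 0 ∈ S) (c : ℝ) :
    hitSet S c = Set.univ :=
  Set.eq_univ_of_forall fun _ => ⟨0, h, Or.inl rfl⟩

theorem measure_exists_forall_inner_outer_nonpos_le (S : Set (EuclideanSpace ℝ N))
    {T : Set (EuclideanSpace ℝ R)} (hT : ∀ y ∈ T, ‖y‖ ≤ 1) {δ : ℝ} (hδ : 0 < δ) (c : ℝ) :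
    stdGaussian (EuclideanSpace ℝ (R × N)) {G | ∃ x ∈ S, ∀ y ∈ T, ⟪outer y x, G⟫_ℝ ≤ 0} ≤
      stdGaussian (EuclideanSpace ℝ N) (hitSet S c) +
        stdGaussian (EuclideanSpace ℝ R) {h | ∀ y ∈ T, ⟪y, h⟫_ℝ ≤ c + 3 * δ} +
        stdGaussian ℝ (Set.Ici δ) := by
  by_cases h_zero : 0 ∈ S
  · rw [hitSet_eq_univ h_zero, measure_univ, add_assoc]
    exact prob_le_one.trans le_self_add
  have h_norm_pos (x : EuclideanSpace ℝ N) (hx : x ∈ S) : 0 < ‖x‖ :=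
    norm_pos_iff.2 fun h => h_zero (h ▸ hx)
  have h_unit : ∀ x ∈ (fun x : EuclideanSpace ℝ N => ‖x‖⁻¹ • x) '' S, ‖x‖ = 1 := by
    rintro _ ⟨x, hx, rfl⟩
    rw [norm_smul, norm_inv, norm_norm, inv_mul_cancel₀ (h_norm_pos x hx).ne']
  refine le_trans ?_ ((measure_exists_forall_inner_outer_nonpos_le_of_norm_eq_one h_unit hT hδ
    c).trans ?_)
  · refine measure_mono fun G ⟨x, hx, hG⟩ => ⟨_, ⟨x, hx, rfl⟩, fun y hy => ?_⟩
    rw [outer_smul_right, real_inner_smul_left]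
    exact mul_nonpos_of_nonneg_of_nonpos (inv_nonneg.2 (norm_nonneg x)) (hG y hy)
  · gcongr
    rintro g ⟨_, ⟨x, hx, rfl⟩, hg⟩
    refine ⟨x, hx, Or.inr ?_⟩
    rw [real_inner_smul_left, inv_mul_eq_div, div_lt_iff₀ (h_norm_pos x hx)] at hg
    linarith

end Escape

section Cone

open scoped InnerProductSpace

variable {R₁ R₂ : Type*} [Fintype R₁] [Fintype R₂]

/-- The intersection of the unit ball with the cone `{y : y₂ ≥ 0}`, which is the polar of the cone
`{v : v₁ = 0, v₂ ≤ 0}` of feasible slacks. -/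
def polarBall (R₁ R₂ : Type*) [Fintype R₁] [Fintype R₂] : Set (EuclideanSpace ℝ (R₁ ⊕ R₂)) :=
  {y | ‖y‖ ≤ 1 ∧ ∀ r, 0 ≤ y (Sum.inr r)}

/-- The projection of `h` onto the cone `{y : y₂ ≥ 0}`; its norm is the distance from `h` to the
cone `{v : v₁ = 0, v₂ ≤ 0}`. -/
def polarProj (h : EuclideanSpace ℝ (R₁ ⊕ R₂)) : EuclideanSpace ℝ (R₁ ⊕ R₂) :=
  WithLp.toLp 2 (Sum.elim (fun r => h (Sum.inl r)) fun r => max (h (Sum.inr r)) 0)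

theorem norm_polarProj_sq (h : EuclideanSpace ℝ (R₁ ⊕ R₂)) :
    ‖polarProj h‖ ^ 2 = ∑ r, h (Sum.inl r) ^ 2 + ∑ r, max (h (Sum.inr r)) 0 ^ 2 := by
  simp only [EuclideanSpace.real_norm_sq_eq, polarProj, Fintype.sum_sum_type, Sum.elim_inl,
    Sum.elim_inr]

theorem inner_polarProj_self (h : EuclideanSpace ℝ (R₁ ⊕ R₂)) :
    ⟪polarProj h, h⟫_ℝ = ‖polarProj h‖ ^ 2 := by
  have h_posPart (s : ℝ) : max s 0 * s = max s 0 ^ 2 := by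
    rcases le_total s 0 with hs | hs
    · simp [max_eq_right hs]
    · rw [max_eq_left hs, sq]
  rw [norm_polarProj_sq]
  simp only [polarProj, PiLp.inner_apply, RCLike.inner_apply', conj_trivial,
    Fintype.sum_sum_type, Sum.elim_inl, Sum.elim_inr, h_posPart, sq]

theorem norm_polarProj_le_of_forall_mem_polarBall {h : EuclideanSpace ℝ (R₁ ⊕ R₂)} {c : ℝ}
    (hc : ∀ y ∈ polarBall R₁ R₂, ⟪y, h⟫_ℝ ≤ c) : ‖polarProj h‖ ≤ c := by
  refine le_of_eq_of_le ?_ (hc (‖polarProj h‖⁻¹ • polarProj h) ⟨?_, fun r => ?_⟩)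
  · rw [real_inner_smul_left, inner_polarProj_self, sq, ← mul_assoc, inv_mul_mul_self]
  · rw [norm_smul, norm_inv, norm_norm]
    exact inv_mul_le_one
  · exact mul_nonneg (inv_nonneg.2 (norm_nonneg _)) (le_max_right _ _)

theorem inner_outer_nonpos_of_mem_polarBall {N : Type*} [Fintype N]
    {y : EuclideanSpace ℝ (R₁ ⊕ R₂)} (hy : y ∈ polarBall R₁ R₂) {x : EuclideanSpace ℝ N}
    {G : EuclideanSpace ℝ ((R₁ ⊕ R₂) × N)} (h_eq : ∀ r, ∑ j, G (Sum.inl r, j) * x j = 0)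
    (h_le : ∀ r, ∑ j, G (Sum.inr r, j) * x j ≤ 0) : ⟪outer y x, G⟫_ℝ ≤ 0 := by
  simp only [inner_outer, Fintype.sum_sum_type, h_eq, mul_zero, Finset.sum_const_zero, zero_add]
  exact Finset.sum_nonpos fun r _ => mul_nonpos_of_nonneg_of_nonpos (hy.2 r) (h_le r)

theorem measure_exists_eq_zero_and_nonpos_le {N : Type*} [Fintype N]
    (S : Set (EuclideanSpace ℝ N)) {δ : ℝ} (hδ : 0 < δ) (c : ℝ) :
    stdGaussian (EuclideanSpace ℝ ((R₁ ⊕ R₂) × N))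
        {G | ∃ x ∈ S, (∀ r, ∑ j, G (Sum.inl r, j) * x j = 0) ∧
          ∀ r, ∑ j, G (Sum.inr r, j) * x j ≤ 0} ≤
      stdGaussian (EuclideanSpace ℝ N) (hitSet S c) +
        stdGaussian (EuclideanSpace ℝ (R₁ ⊕ R₂)) {h | ‖polarProj h‖ ≤ c + 3 * δ} +
        stdGaussian ℝ (Set.Ici δ) := by
  refine le_trans (measure_mono ?_) ((measure_exists_forall_inner_outer_nonpos_le S
    (T := polarBall R₁ R₂) (fun y hy => hy.1) hδ c).trans ?_)
  · exact fun G ⟨x, hx, h_eq, h_le⟩ =>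
      ⟨x, hx, fun y hy => inner_outer_nonpos_of_mem_polarBall hy h_eq h_le⟩
  · gcongr with h
    exact norm_polarProj_le_of_forall_mem_polarBall

end Cone

section Concentration

section Moments

variable {μ : ℝ} {v : NNReal} {φ : ℝ → ℝ}

theorem integrable_pow_four_gaussianReal (μ : ℝ) (v : NNReal) :
    Integrable (fun t : ℝ => t ^ 4) (gaussianReal μ v) := by
  have h_norm := (memLp_id_gaussianReal (μ := μ) (v := v) 4).integrable_norm_pow (p := 4) (by simp)
  simpa only [id, Real.norm_eq_abs, Even.pow_abs (by decide : Even 4)] using h_norm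

theorem memLp_gaussianReal_of_abs_le_sq (hφ : Measurable φ) (h_le : ∀ t, |φ t| ≤ t ^ 2) :
    MemLp φ 2 (gaussianReal μ v) := by
  refine (memLp_two_iff_integrable_sq hφ.aestronglyMeasurable).2 <|
    (integrable_pow_four_gaussianReal μ v).mono' (by fun_prop) (ae_of_all _ fun t => ?_)
  rw [Real.norm_eq_abs, abs_pow]
  exact (pow_le_pow_left₀ (abs_nonneg _) (h_le t) 2).trans_eq (by ring)

theorem variance_gaussianReal_le_of_abs_le_sq (hφ : Measurable φ) (h_le : ∀ t, |φ t| ≤ t ^ 2) :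
    Var[φ; gaussianReal μ v] ≤ ∫ t, t ^ 4 ∂gaussianReal μ v := by
  refine (variance_le_expectation_sq hφ.aestronglyMeasurable).trans <|
    integral_mono (memLp_gaussianReal_of_abs_le_sq hφ h_le).integrable_sq
      (integrable_pow_four_gaussianReal μ v) fun t => ?_
  rw [Pi.pow_apply, ← sq_abs]
  exact (pow_le_pow_left₀ (abs_nonneg _) (h_le t) 2).trans_eq (by ring)

theorem abs_posPart_sq_le (t : ℝ) : |max t 0 ^ 2| ≤ t ^ 2 := by
  rw [abs_of_nonneg (sq_nonneg _), sq_le_sq, abs_of_nonneg (le_max_right t 0)]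
  exact max_le (le_abs_self t) (abs_nonneg t)

theorem integral_sq_gaussianReal (v : NNReal) : ∫ t, t ^ 2 ∂gaussianReal 0 v = v := by
  have h_var := variance_fun_id_gaussianReal (μ := 0) (v := v)
  rwa [variance_of_integral_eq_zero (by fun_prop) integral_id_gaussianReal] at h_var

theorem integral_posPart_sq_gaussianReal (v : NNReal) :
    ∫ t, max t 0 ^ 2 ∂gaussianReal 0 v = v / 2 := by
  have h_symm : ∫ t, max (-t) 0 ^ 2 ∂gaussianReal 0 v = ∫ t, max t 0 ^ 2 ∂gaussianReal 0 v := by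
    conv_rhs => rw [← neg_zero (G := ℝ), ← gaussianReal_map_neg]
    rw [integral_map (by fun_prop) (by fun_prop), neg_zero]
  have h_int : Integrable (fun t : ℝ => max t 0 ^ 2) (gaussianReal 0 v) :=
    (memLp_gaussianReal_of_abs_le_sq (by fun_prop) abs_posPart_sq_le).integrable one_le_two
  have h_int_neg : Integrable (fun t : ℝ => max (-t) 0 ^ 2) (gaussianReal 0 v) :=
    (memLp_gaussianReal_of_abs_le_sq (by fun_prop) fun t =>
      (abs_posPart_sq_le (-t)).trans_eq (neg_sq t)).integrable one_le_two
  have h_split (t : ℝ) : max t 0 ^ 2 + max (-t) 0 ^ 2 = t ^ 2 := by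
    rcases le_total t 0 with ht | ht
    · rw [max_eq_right ht, max_eq_left (neg_nonneg.2 ht)]
      ring
    · rw [max_eq_left ht, max_eq_right (neg_nonpos.2 ht)]
      ring
  have h_add := integral_add h_int h_int_neg
  simp only [h_split, integral_sq_gaussianReal, h_symm] at h_add
  linarith

end Moments

section Coordinates

variable {ι : Type*} [Fintype ι] {φ : ι → ℝ → ℝ}

theorem measurePreserving_apply_stdGaussian (i : ι) :
    MeasurePreserving (fun h : EuclideanSpace ℝ ι => h i) (stdGaussian (EuclideanSpace ℝ ι))
      (gaussianReal 0 1) := by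
  refine ⟨by fun_prop, ?_⟩
  rw [← map_pi_eq_stdGaussian, Measure.map_map (by fun_prop) (by fun_prop)]
  exact (measurePreserving_eval (fun _ : ι => gaussianReal 0 1) i).map_eq

theorem memLp_sum_stdGaussian (hφ : ∀ i, MemLp (φ i) 2 (gaussianReal 0 1)) :
    MemLp (fun h : EuclideanSpace ℝ ι => ∑ i, φ i (h i)) 2
      (stdGaussian (EuclideanSpace ℝ ι)) :=
  memLp_finsetSum _ fun i _ =>
    (hφ i).comp_measurePreserving (measurePreserving_apply_stdGaussian i)

theorem integral_sum_stdGaussian (hφ : ∀ i, Integrable (φ i) (gaussianReal 0 1)) :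
    ∫ h, ∑ i, φ i (h i) ∂stdGaussian (EuclideanSpace ℝ ι) =
      ∑ i, ∫ t, φ i t ∂gaussianReal 0 1 := by
  have h_pres := measurePreserving_apply_stdGaussian (ι := ι)
  have h_int (i : ι) : Integrable (fun h : EuclideanSpace ℝ ι => φ i (h i))
      (stdGaussian (EuclideanSpace ℝ ι)) := (h_pres i).integrable_comp_of_integrable (hφ i)
  rw [integral_finsetSum _ fun i _ => h_int i]
  refine Finset.sum_congr rfl fun i _ => ?_
  have h_meas : AEStronglyMeasurable (φ i)
      ((stdGaussian (EuclideanSpace ℝ ι)).map fun h => h i) := by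
    rw [(h_pres i).map_eq]
    exact (hφ i).aestronglyMeasurable
  rw [← integral_map (h_pres i).aemeasurable h_meas, (h_pres i).map_eq]

theorem variance_sum_stdGaussian (hφ : ∀ i, MemLp (φ i) 2 (gaussianReal 0 1)) :
    Var[fun h => ∑ i, φ i (h i); stdGaussian (EuclideanSpace ℝ ι)] =
      ∑ i, Var[φ i; gaussianReal 0 1] := by
  have h_meas := (memLp_sum_stdGaussian hφ).aestronglyMeasurable.aemeasurable
  rw [← map_pi_eq_stdGaussian] at h_meas ⊢
  rw [variance_map h_meas (by fun_prop), ← variance_sum_pi hφ]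
  congr 1
  ext h
  simp only [Function.comp_apply, Finset.sum_apply]

theorem measure_sum_stdGaussian_le (hφ : ∀ i, Measurable (φ i)) (h_le : ∀ i t, |φ i t| ≤ t ^ 2)
    {η : ℝ} (hη : 0 < η) :
    stdGaussian (EuclideanSpace ℝ ι)
        {h | ∑ i, φ i (h i) ≤ ∑ i, ∫ t, φ i t ∂gaussianReal 0 1 - η} ≤
      ENNReal.ofReal (Fintype.card ι * (∫ t, t ^ 4 ∂gaussianReal 0 1) / η ^ 2) := by
  have h_memLp (i : ι) := memLp_gaussianReal_of_abs_le_sq (μ := 0) (v := 1) (hφ i) (h_le i)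
  have h_var : Var[fun h => ∑ i, φ i (h i); stdGaussian (EuclideanSpace ℝ ι)] ≤
      Fintype.card ι * ∫ t, t ^ 4 ∂gaussianReal 0 1 := by
    rw [variance_sum_stdGaussian h_memLp, ← nsmul_eq_mul]
    exact Finset.sum_le_card_nsmul _ _ _ fun i _ =>
      variance_gaussianReal_le_of_abs_le_sq (hφ i) (h_le i)
  refine (measure_mono fun h hh => ?_).trans <|
    (meas_ge_le_variance_div_sq (memLp_sum_stdGaussian h_memLp) hη).trans <|
    ENNReal.ofReal_le_ofReal (div_le_div_of_nonneg_right h_var (sq_nonneg η))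
  rw [Set.mem_ofPred_eq] at hh ⊢
  rw [integral_sum_stdGaussian fun i => (h_memLp i).integrable one_le_two, abs_sub_comm]
  exact (by linarith : η ≤ _).trans (le_abs_self _)

end Coordinates

variable {R₁ R₂ : Type*} [Fintype R₁] [Fintype R₂]

theorem measure_norm_polarProj_sq_le {η : ℝ} (hη : 0 < η) :
    stdGaussian (EuclideanSpace ℝ (R₁ ⊕ R₂))
        {h | ‖polarProj h‖ ^ 2 ≤ (Fintype.card R₁ : ℝ) + (Fintype.card R₂ : ℝ) / 2 - η} ≤
      ENNReal.ofReal ((Fintype.card R₁ + Fintype.card R₂) *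
        (∫ t, t ^ 4 ∂gaussianReal 0 1) / η ^ 2) := by
  set φ : R₁ ⊕ R₂ → ℝ → ℝ := Sum.elim (fun _ t => t ^ 2) fun _ t => max t 0 ^ 2
  have h_meas : ∀ r, Measurable (φ r) := by
    rintro (_ | _) <;> simp only [φ, Sum.elim_inl, Sum.elim_inr] <;> fun_prop
  have h_le : ∀ r t, |φ r t| ≤ t ^ 2 := by
    rintro (_ | _) t
    · exact (abs_of_nonneg (sq_nonneg t)).le
    · exact abs_posPart_sq_le t
  have h_chebyshev := measure_sum_stdGaussian_le h_meas h_le hη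
  simpa only [φ, Fintype.sum_sum_type, Sum.elim_inl, Sum.elim_inr, integral_sq_gaussianReal,
    integral_posPart_sq_gaussianReal, Finset.sum_const, Finset.card_univ, nsmul_eq_mul,
    NNReal.coe_one, mul_one, mul_one_div, ← norm_polarProj_sq, Fintype.card_sum,
    Nat.cast_add] using h_chebyshev

theorem measure_norm_polarProj_le {s : ℝ} (hs : 0 < s) :
    stdGaussian (EuclideanSpace ℝ (R₁ ⊕ R₂))
        {h | ‖polarProj h‖ ≤ √((Fintype.card R₁ : ℝ) + (Fintype.card R₂ : ℝ) / 2) - s} ≤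
      ENNReal.ofReal (2 * (∫ t, t ^ 4 ∂gaussianReal 0 1) / s ^ 2) := by
  set M : ℝ := Fintype.card R₁ + Fintype.card R₂ / 2 with hM
  rcases lt_or_ge √M s with h_lt | h_ge
  · have h_empty : {h : EuclideanSpace ℝ (R₁ ⊕ R₂) | ‖polarProj h‖ ≤ √M - s} = ∅ :=
      Set.eq_empty_of_forall_notMem fun h (hh : ‖polarProj h‖ ≤ √M - s) => by
        linarith [norm_nonneg (polarProj h)]
    rw [h_empty, measure_empty]
    exact zero_le
  have hM_pos : 0 < M := Real.sqrt_pos.1 (hs.trans_le h_ge)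
  have hM_sq : √M ^ 2 = M := Real.sq_sqrt hM_pos.le
  have h_card : (Fintype.card R₁ + Fintype.card R₂ : ℝ) ≤ 2 * M := by
    linarith [(Nat.cast_nonneg (Fintype.card R₁) : (0 : ℝ) ≤ _)]
  have h_moment : 0 ≤ ∫ t : ℝ, t ^ 4 ∂gaussianReal 0 1 := integral_nonneg fun t => by positivity
  refine (measure_mono fun h (hh : ‖polarProj h‖ ≤ √M - s) => ?_).trans
    ((measure_norm_polarProj_sq_le (mul_pos hs (hs.trans_le h_ge))).trans
      (ENNReal.ofReal_le_ofReal ?_))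
  · have h_sq := pow_le_pow_left₀ (norm_nonneg _) hh 2
    rw [Set.mem_ofPred_eq]
    nlinarith [mul_le_mul_of_nonneg_left h_ge hs.le]
  · rw [mul_pow, hM_sq, div_le_div_iff₀ (by positivity) (by positivity)]
    nlinarith [mul_le_mul_of_nonneg_right h_card (mul_nonneg h_moment (sq_nonneg s))]

end Concentration

section Programs

theorem IsIIDStdNormal.hasLaw_stdGaussian {Ω ι κ : Type*} [MeasurableSpace Ω] [Fintype κ]
    {X : ι → Ω → ℝ} {P : Measure Ω} [IsProbabilityMeasure P] (hX : IsIIDStdNormal X P)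
    {e : κ → ι} (he : e.Injective) :
    HasLaw (fun ω => WithLp.toLp 2 fun k => X (e k) ω) (stdGaussian (EuclideanSpace ℝ κ)) P := by
  have h_meas (k : κ) : AEMeasurable (X (e k)) P := (hX.1 (e k)).aemeasurable
  have h_pi : P.map (fun ω k => X (e k) ω) = Measure.pi fun _ => gaussianReal 0 1 := by
    rw [(iIndepFun_iff_map_fun_eq_pi_map h_meas).1 (hX.2.precomp he)]
    simp only [fun k => (hX.1 (e k)).map_eq]
  refine ⟨(WithLp.measurable_toLp 2 _).comp_aemeasurable (aemeasurable_pi_lambda _ h_meas), ?_⟩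
  rw [← map_pi_eq_stdGaussian, ← h_pi, AEMeasurable.map_map_of_aemeasurable (by fun_prop)
    (aemeasurable_pi_lambda _ h_meas)]
  rfl

theorem xi_lt_iff {m₁ m₂ n : ℕ} {f : EuclideanSpace ℝ (Fin n) → ℝ} {A : Matrix (Fin m₁) (Fin n) ℝ}
    {B : Matrix (Fin m₂) (Fin n) ℝ} {t : ℝ} :
    xi f A B < t ↔ ∃ x ∈ {x | f x < t}, x ∈ feasibleSet A B := by
  simp only [xi, iInf_lt_iff, EReal.coe_lt_coe_iff, exists_prop, Set.mem_ofPred_eq, and_comm]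

variable {Ω Ω' : Type*} [MeasurableSpace Ω] [MeasurableSpace Ω'] {P : Measure Ω}
  [IsProbabilityMeasure P] {Q : Measure Ω'} [IsProbabilityMeasure Q] {m₁ m₂ n : ℕ}
  {A : Ω → Matrix (Fin m₁) (Fin n) ℝ} {B : Ω → Matrix (Fin m₂) (Fin n) ℝ} {g : Fin n → Ω' → ℝ}

theorem measure_exists_mem_feasibleSet_le (hAB : IsIIDStdNormal (entries A B) P)
    (S : Set (EuclideanSpace ℝ (Fin n))) {c δ : ℝ} (hδ : 0 < δ)
    (hc : c + 5 * δ ≤ √((m₁ : ℝ) + (m₂ : ℝ) / 2)) :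
    P {ω | ∃ x ∈ S, x ∈ feasibleSet (A ω) (B ω)} ≤
      stdGaussian (EuclideanSpace ℝ (Fin n)) (hitSet S c) +
        ENNReal.ofReal (((∫ t, t ^ 4 ∂gaussianReal 0 1) / 2 + 1) / δ ^ 2) := by
  have h_law := hAB.hasLaw_stdGaussian (Equiv.sumProdDistrib (Fin m₁) (Fin m₂) (Fin n)).injective
  have h_escape := measure_exists_eq_zero_and_nonpos_le (R₁ := Fin m₁) (R₂ := Fin m₂) S hδ c
  have h_cone : stdGaussian (EuclideanSpace ℝ (Fin m₁ ⊕ Fin m₂)) {h | ‖polarProj h‖ ≤ c + 3 * δ} ≤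
      ENNReal.ofReal (2 * (∫ t, t ^ 4 ∂gaussianReal 0 1) / (2 * δ) ^ 2) := by
    refine (measure_mono fun h (hh : ‖polarProj h‖ ≤ c + 3 * δ) => ?_).trans
      (measure_norm_polarProj_le (by positivity : 0 < 2 * δ))
    rw [Set.mem_ofPred_eq, Fintype.card_fin, Fintype.card_fin]
    linarith
  have h_moment : 0 ≤ ∫ t : ℝ, t ^ 4 ∂gaussianReal 0 1 := integral_nonneg fun t => by positivity
  rw [← h_law.map_eq] at h_escape
  refine (measure_mono ?_).trans <| (Measure.le_map_apply h_law.aemeasurable _).trans <|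
    h_escape.trans ?_
  · exact fun ω ⟨x, hx, hA, hB⟩ => ⟨x, hx, congrFun hA, hB⟩
  · rw [add_assoc]
    gcongr
    refine (add_le_add h_cone (measure_stdGaussian_real_Ici_le hδ)).trans_eq ?_
    rw [← ENNReal.ofReal_add (by positivity) (by positivity)]
    congr 1
    field_simp

theorem exists_mem_auxFeasibleSet_of_mem_hitSet {S : Set (EuclideanSpace ℝ (Fin n))}
    {ε₁ ε₅ : ℝ} {v : Fin n → ℝ}
    (hv : WithLp.toLp 2 v ∈ hitSet S ((1 - ε₁) * √((m₁ : ℝ) + (m₂ : ℝ) / 2) - ε₅ * √(n : ℝ))) :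
    ∃ x ∈ S, x ∈ auxFeasibleSet m₁ m₂ ε₁ ε₅ v := by
  obtain ⟨x, hx, rfl | hv⟩ := hv
  · exact ⟨0, hx, by simp [auxFeasibleSet]⟩
  · exact ⟨x, hx, hv.le⟩

theorem stdGaussian_le_of_forall_toLp_mem (hg : IsIIDStdNormal g Q)
    {D : Set (EuclideanSpace ℝ (Fin n))} (hD : MeasurableSet D) {s : Set Ω'}
    (h : ∀ ω, WithLp.toLp 2 (fun i => g i ω) ∈ D → ω ∈ s) :
    stdGaussian (EuclideanSpace ℝ (Fin n)) D ≤ Q s := by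
  have h_law := hg.hasLaw_stdGaussian Function.injective_id
  rw [← h_law.map_eq, Measure.map_apply_of_aemeasurable h_law.aemeasurable hD]
  exact measure_mono h

theorem measure_compl_le_xi_le (hAB : IsIIDStdNormal (entries A B) P) (hg : IsIIDStdNormal g Q)
    (f : EuclideanSpace ℝ (Fin n) → ℝ) (t : ℝ) {ε₁ ε₅ δ : ℝ} (hδ : 0 < δ)
    (hδ_le : (1 - ε₁) * √((m₁ : ℝ) + (m₂ : ℝ) / 2) - ε₅ * √(n : ℝ) + 5 * δ ≤
      √((m₁ : ℝ) + (m₂ : ℝ) / 2)) :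
    P {ω | (t : EReal) ≤ xi f (A ω) (B ω)}ᶜ ≤
      Q {ω | 0 ≤ auxL f t m₁ m₂ ε₁ ε₅ fun i => g i ω}ᶜ +
        ENNReal.ofReal (((∫ t, t ^ 4 ∂gaussianReal 0 1) / 2 + 1) / δ ^ 2) := by
  have h_feasible := measure_exists_mem_feasibleSet_le hAB {x | f x < t} hδ hδ_le
  have h_compl : {ω | (t : EReal) ≤ xi f (A ω) (B ω)}ᶜ =
      {ω | ∃ x ∈ {x | f x < t}, x ∈ feasibleSet (A ω) (B ω)} := by
    ext ω
    rw [Set.mem_compl_iff, Set.mem_ofPred_eq, not_le, xi_lt_iff, Set.mem_ofPred_eq]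
  rw [h_compl]
  refine h_feasible.trans (add_le_add_left ?_ _)
  refine stdGaussian_le_of_forall_toLp_mem hg (isOpen_hitSet _ _).measurableSet
    fun ω hω (h_nonneg : 0 ≤ auxL _ _ _ _ _ _ _) => ?_
  obtain ⟨x, hx, hx_aux⟩ := exists_mem_auxFeasibleSet_of_mem_hitSet hω
  have h_le : (0 : EReal) ≤ ((f x - t : ℝ) : EReal) := h_nonneg.trans (iInf₂_le x hx_aux)
  exact (sub_neg.2 hx).not_ge (EReal.coe_nonneg.1 h_le)

theorem measure_compl_lt_xi_le (hAB : IsIIDStdNormal (entries A B) P) (hg : IsIIDStdNormal g Q)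
    (f : EuclideanSpace ℝ (Fin n) → ℝ) (t : ℝ) {ε₁ ε₅ δ : ℝ} (hδ : 0 < δ)
    (hδ_le : (1 - ε₁) * √((m₁ : ℝ) + (m₂ : ℝ) / 2) - ε₅ * √(n : ℝ) + 5 * δ ≤
      √((m₁ : ℝ) + (m₂ : ℝ) / 2)) :
    P {ω | (t : EReal) < xi f (A ω) (B ω)}ᶜ ≤
      Q {ω | 0 < auxL f t m₁ m₂ ε₁ ε₅ fun i => g i ω}ᶜ +
        ENNReal.ofReal (((∫ t, t ^ 4 ∂gaussianReal 0 1) / 2 + 1) / δ ^ 2) := by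
  set c := (1 - ε₁) * √((m₁ : ℝ) + (m₂ : ℝ) / 2) - ε₅ * √(n : ℝ)
  -- The infimum `xi` need not be attained, so `xi ≤ t` is reached through levels `uₖ ↓ t`.
  obtain ⟨u, hu_anti, hu_gt, hu_lim⟩ := exists_seq_strictAnti_tendsto t
  have h_measurable (k : ℕ) : MeasurableSet (hitSet {x | f x < u k} c) :=
    (isOpen_hitSet _ _).measurableSet
  have h_antitone : Antitone fun k => hitSet {x | f x < u k} c := fun k l hkl =>
    hitSet_mono (fun x hx => lt_of_lt_of_le hx (hu_anti.antitone hkl)) c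
  have h_lim := tendsto_measure_iInter_atTop (μ := stdGaussian (EuclideanSpace ℝ (Fin n)))
    (fun k => (h_measurable k).nullMeasurableSet) h_antitone ⟨0, measure_ne_top _ _⟩
  have h_aux : stdGaussian (EuclideanSpace ℝ (Fin n)) (⋂ k, hitSet {x | f x < u k} c) ≤
      Q {ω | 0 < auxL f t m₁ m₂ ε₁ ε₅ fun i => g i ω}ᶜ := by
    refine stdGaussian_le_of_forall_toLp_mem hg (MeasurableSet.iInter h_measurable) fun ω hω => ?_
    have h_le (k : ℕ) :
        auxL f t m₁ m₂ ε₁ ε₅ (fun i => g i ω) ≤ ((u k - t : ℝ) : EReal) := by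
      obtain ⟨x, hx, hx_aux⟩ := exists_mem_auxFeasibleSet_of_mem_hitSet (Set.mem_iInter.1 hω k)
      exact (iInf₂_le x hx_aux).trans (EReal.coe_le_coe_iff.2 (sub_le_sub_right hx.le t))
    have h_zero := (continuous_coe_real_ereal.tendsto _).comp (hu_lim.sub_const t)
    rw [sub_self] at h_zero
    exact (ge_of_tendsto' h_zero h_le).not_gt
  refine (ge_of_tendsto' (h_lim.add_const _) fun k => ?_).trans (add_le_add_left h_aux _)
  refine (measure_mono fun ω hω => ?_).trans (measure_exists_mem_feasibleSet_le hAB _ hδ hδ_le)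
  rw [Set.mem_compl_iff, Set.mem_ofPred_eq, not_lt] at hω
  exact xi_lt_iff.1 (hω.trans_lt (EReal.coe_lt_coe_iff.2 (hu_gt k)))

end Programs

section Asymptotics

variable {Ω Ω' : ℕ → Type*} [∀ n, MeasurableSpace (Ω n)] [∀ n, MeasurableSpace (Ω' n)]
  {P : ∀ n, Measure (Ω n)} {Q : ∀ n, Measure (Ω' n)} {s : ∀ n, Set (Ω n)} {s' : ∀ n, Set (Ω' n)}

theorem WithOverwhelmingProb.tendsto_prob (hs : WithOverwhelmingProb P s) :
    Tendsto (fun n => prob (P n) (s n)) atTop (𝓝 1) := by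
  obtain ⟨c, hc, h_ge⟩ := hs
  have h_exp : Tendsto (fun n : ℕ => 1 - Real.exp (-c * n)) atTop (𝓝 1) := by
    simpa only [sub_zero, Function.comp_apply] using (Real.tendsto_exp_atBot.comp
      (tendsto_natCast_atTop_atTop.const_mul_atTop_of_neg (neg_lt_zero.2 hc))).const_sub 1
  exact tendsto_of_tendsto_of_tendsto_of_le_of_le' h_exp tendsto_const_nhds h_ge
    (Eventually.of_forall fun n => sub_le_self 1 measureReal_nonneg)

theorem tendsto_prob_one_iff [∀ n, IsFiniteMeasure (P n)] :
    Tendsto (fun n => prob (P n) (s n)) atTop (𝓝 1) ↔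
      Tendsto (fun n => P n (s n)ᶜ) atTop (𝓝 0) := by
  rw [← ENNReal.tendsto_toReal_iff (fun n => measure_ne_top _ _) ENNReal.zero_ne_top,
    ENNReal.toReal_zero]
  refine ⟨fun h => ?_, fun h => ?_⟩
  · simpa only [prob, measureReal_def, sub_sub_cancel, sub_self] using h.const_sub 1
  · simpa only [prob, measureReal_def, sub_zero] using h.const_sub 1

theorem tendsto_prob_of_measure_compl_le [∀ n, IsFiniteMeasure (P n)] [∀ n, IsFiniteMeasure (Q n)]
    (hs' : Tendsto (fun n => prob (Q n) (s' n)) atTop (𝓝 1)) {C κ : ℝ} (hκ : 0 < κ)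
    (h_le : ∀ n : ℕ, 0 < κ * √(n : ℝ) →
      P n (s n)ᶜ ≤ Q n (s' n)ᶜ + ENNReal.ofReal (C / (κ * √(n : ℝ)) ^ 2)) :
    Tendsto (fun n => prob (P n) (s n)) atTop (𝓝 1) := by
  have h_scale : Tendsto (fun n : ℕ => κ * √(n : ℝ)) atTop atTop :=
    (Real.tendsto_sqrt_atTop.comp tendsto_natCast_atTop_atTop).const_mul_atTop hκ
  have h_error : Tendsto (fun n : ℕ => ENNReal.ofReal (C / (κ * √(n : ℝ)) ^ 2)) atTop (𝓝 0) := by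
    simpa only [ENNReal.ofReal_zero, Function.comp_apply] using ENNReal.tendsto_ofReal
      (((tendsto_pow_atTop two_ne_zero).comp h_scale).const_div_atTop C)
  have h_sum := (tendsto_prob_one_iff.1 hs').add h_error
  rw [add_zero] at h_sum
  exact tendsto_prob_one_iff.2 <| tendsto_of_tendsto_of_tendsto_of_le_of_le' tendsto_const_nhds
    h_sum (Eventually.of_forall fun _ => zero_le)
    ((h_scale.eventually_gt_atTop 0).mono h_le)

end Asymptotics

end RandLinCons

theorem mainTheorem1_general
    {Ω Ω' : ℕ → Type*} [∀ n, MeasurableSpace (Ω n)] [∀ n, MeasurableSpace (Ω' n)]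
    (P : ∀ n, Measure (Ω n)) [∀ n, IsProbabilityMeasure (P n)]
    (Q : ∀ n, Measure (Ω' n)) [∀ n, IsProbabilityMeasure (Q n)]
    (m₁ m₂ : ℕ → ℕ)
    (A : ∀ n, Ω n → Matrix (Fin (m₁ n)) (Fin n) ℝ)
    (B : ∀ n, Ω n → Matrix (Fin (m₂ n)) (Fin n) ℝ)
    (hAB : ∀ n, RandLinCons.IsIIDStdNormal (RandLinCons.entries (A n) (B n)) (P n))
    (g : ∀ n, Fin n → Ω' n → ℝ)
    (hg : ∀ n, RandLinCons.IsIIDStdNormal (g n) (Q n))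
    (f : ∀ n, EuclideanSpace ℝ (Fin n) → ℝ)
    (ε₁ ε₅ : ℝ) (hε₁ : 0 ≤ ε₁) (hε₅ : 0 < ε₅)
    (ξD : ℕ → ℝ) :
    (Tendsto (fun n => RandLinCons.prob (Q n) {ω | 0 ≤ RandLinCons.auxL (f n) (ξD n) (m₁ n) (m₂ n)
        ε₁ ε₅ (fun i => g n i ω)}) atTop (𝓝 1) →
      Tendsto (fun n => RandLinCons.prob (P n)
        {ω | (ξD n : EReal) ≤ RandLinCons.xi (f n) (A n ω) (B n ω)}) atTop (𝓝 1)) ∧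
    (Tendsto (fun n => RandLinCons.prob (Q n) {ω | 0 < RandLinCons.auxL (f n) (ξD n) (m₁ n) (m₂ n)
        ε₁ ε₅ (fun i => g n i ω)}) atTop (𝓝 1) →
      Tendsto (fun n => RandLinCons.prob (P n)
        {ω | (ξD n : EReal) < RandLinCons.xi (f n) (A n ω) (B n ω)}) atTop (𝓝 1)) := by
  have h_coeff (n : ℕ) : (1 - ε₁) * √((m₁ n : ℝ) + (m₂ n : ℝ) / 2) - ε₅ * √(n : ℝ) +
      5 * (ε₅ / 5 * √(n : ℝ)) ≤ √((m₁ n : ℝ) + (m₂ n : ℝ) / 2) := by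
    linarith [mul_nonneg hε₁ (Real.sqrt_nonneg ((m₁ n : ℝ) + (m₂ n : ℝ) / 2))]
  have h_pos : 0 < ε₅ / 5 := by positivity
  exact ⟨fun h => RandLinCons.tendsto_prob_of_measure_compl_le h h_pos fun n hn =>
      RandLinCons.measure_compl_le_xi_le (hAB n) (hg n) (f n) (ξD n) hn (h_coeff n),
    fun h => RandLinCons.tendsto_prob_of_measure_compl_le h h_pos fun n hn =>
      RandLinCons.measure_compl_lt_xi_le (hAB n) (hg n) (f n) (ξD n) hn (h_coeff n)⟩

theorem mainTheorem1
    {Ω Ω' : ℕ → Type*} [∀ n, MeasurableSpace (Ω n)] [∀ n, MeasurableSpace (Ω' n)]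
    (P : ∀ n, Measure (Ω n)) [∀ n, IsProbabilityMeasure (P n)]
    (Q : ∀ n, Measure (Ω' n)) [∀ n, IsProbabilityMeasure (Q n)]
    (α₁ α₂ : ℝ) (m₁ m₂ : ℕ → ℕ)
    (hm₁ : Tendsto (fun n : ℕ => (m₁ n : ℝ) / (n : ℝ)) atTop (𝓝 α₁))
    (hm₂ : Tendsto (fun n : ℕ => (m₂ n : ℝ) / (n : ℝ)) atTop (𝓝 α₂))
    (A : ∀ n, Ω n → Matrix (Fin (m₁ n)) (Fin n) ℝ)
    (B : ∀ n, Ω n → Matrix (Fin (m₂ n)) (Fin n) ℝ)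
    (hAB : ∀ n, RandLinCons.IsIIDStdNormal (RandLinCons.entries (A n) (B n)) (P n))
    (g : ∀ n, Fin n → Ω' n → ℝ)
    (hg : ∀ n, RandLinCons.IsIIDStdNormal (g n) (Q n))
    (f : ∀ n, EuclideanSpace ℝ (Fin n) → ℝ)
    (hfin : RandLinCons.WithOverwhelmingProb P fun n =>
      {ω | RandLinCons.xi (f n) (A n ω) (B n ω) ≠ ⊥ ∧ RandLinCons.xi (f n) (A n ω) (B n ω) ≠ ⊤})
    (ε₁ ε₅ : ℝ) (hε₁ : 0 < ε₁) (hε₅ : 0 < ε₅)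
    (ξD : ℕ → ℝ)
    (hξD : RandLinCons.WithOverwhelmingProb Q fun n =>
      {ω | 0 ≤ RandLinCons.auxL (f n) (ξD n) (m₁ n) (m₂ n) ε₁ ε₅ (fun i => g n i ω)}) :
    Tendsto (fun n => RandLinCons.prob (P n)
        {ω | (ξD n : EReal) ≤ RandLinCons.xi (f n) (A n ω) (B n ω)}) atTop (𝓝 1) ∧
    ((RandLinCons.WithOverwhelmingProb Q fun n =>
        {ω | 0 < RandLinCons.auxL (f n) (ξD n) (m₁ n) (m₂ n) ε₁ ε₅ (fun i => g n i ω)}) →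
      Tendsto (fun n => RandLinCons.prob (P n)
        {ω | (ξD n : EReal) < RandLinCons.xi (f n) (A n ω) (B n ω)}) atTop (𝓝 1)) := by
  have h_general := mainTheorem1_general P Q m₁ m₂ A B hAB g hg f ε₁ ε₅ hε₁.le hε₅ ξD
  exact ⟨h_general.1 hξD.tendsto_prob, fun hpos => h_general.2 hpos.tendsto_prob⟩
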